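/- Let $P_{Y|X}$ be a discrete memoryless channel with finite alphabets $\mathcal X,\mathcal Y$, let $q:\mathcal X\times\mathcal Y\to\mathbb R$ be a decoding metric, and let $q_n(\mathbf x,\mathbf y)=\frac1n\sum_{k=1}^n q(x_k,y_k)$. A code of length $n$ and rate $R\ge 0$ has $\lceil 2^{nR}\rceil$ codewords $\mathbf x(m)$; the decoder outputs $m$ iff $q_n(\mathbf x(m),\mathbf y)>q_n(\mathbf x(m'),\mathbf y)$ for all $m'\ne m$ (if there is no such $m$, an error is declared). The rate $R$ is achievable if some sequence of codes of rate $R$ has average error probability (equiprobable messages) tending to $0$; the mismatch capacity $C_q(P_{Y|X})$ is the supremum of the achievable rates. Let $\mathcal X_1,\mathcal X_2$ be finite sets, $P_{X_1,X_2}$ a p.m.f. on $\mathcal X_1\times\mathcal X_2$, $\phi:\mathcal X_1\times\mathcal X_2\to\mathcal X$ a map, $P=P_{X_1,X_2}\cdot P_{Y|\phi(X_1,X_2)}$, that is, $P(x_1,x_2,y)=P_{X_1,X_2}(x_1,x_2)P_{Y|X}(y|\phi(x_1,x_2))$, and write $q(x_1,x_2,y)=q(\phi(x_1,x_2),y)$.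 Let $\mathcal G$ be the set of p.m.f.s $f$ on $\mathcal X_1\times\mathcal X_2\times\mathcal Y$ with $f_{X_1,X_2}=P_{X_1,X_2}$ and $\mathbb E_f\, q\ge\mathbb E_P\, q$, and let $$\mathcal L_1=\{f\in\mathcal G: f_{X_2,Y}=P_{X_2,Y}\},\quad \mathcal L_2=\{f\in\mathcal G: f_{X_1,Y}=P_{X_1,Y}\},\quad \mathcal L_0=\{f\in\mathcal G: f_Y=P_Y\}.$$ With $|x|^+=\max\{0,x\}$ and information quantities in bits, put $$R_1'(P)=\min_{f\in\mathcal L_1}I_f(X_1;Y,X_2),\qquad R_2'(P)=\min_{f\in\mathcal L_2}I_f(X_2;Y|X_1),$$ $$R_1''(P,R_2)=\min_{f\in\mathcal L_0}\{I_f(X_1;Y)+|I_f(X_2;Y|X_1)-R_2|^+\},$$ $$R_2''(P,R_1)=\min_{f\in\mathcal L_0}\{I_f(X_2;Y)-I_f(X_2;X_1)+|I_f(X_1;Y,X_2)-R_1|^+\},$$ $$r_1(P)=\min_{f\in\mathcal L_1}I_f(X_1;Y|X_2),\qquad r_2(P,R_1)=\min_{f\in\mathcal L_0}\{I_f(X_2;Y)+|I_f(X_1;Y|X_2)-R_1|^+\},$$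 $$R^*=\max\{R_2'(P)+R_1''(P,R_2'(P)),\; r_1(P)+r_2(P,r_1(P))\}.$$ Then: 1. $C_q(P_{Y|X})\ge R^*$. 2. The rate is achieved by superposition coding, with user 2 as the cognitive user for the first term of the maximum and with user 1 as the cognitive user for the second. Precisely, for every $R$ with $0\le R<R_2'(P)+R_1''(P,R_2'(P))$ there are $R_1,R_2\ge 0$ with $R=R_1+R_2$ and types $Q_n$ of order $n$ on $\mathcal X_1\times\mathcal X_2$ with $Q_n\to P_{X_1,X_2}$ such that the error probability of the following random code, averaged over its codebooks, tends to $0$: draw $\lceil 2^{nR_1}\rceil$ sequences $\mathbf x_1(i)$ independently and uniformly from the type class of $(Q_n)_{X_1}$; for each $i$ draw $\lceil 2^{nR_2}\rceil$ sequences $\mathbf x_2(i,j)$, conditionally independent and uniform on the set of $\mathbf x_2$ for which $(\mathbf x_1(i),\mathbf x_2)$ has type $Q_n$; the codewords are $\phi(\mathbf x_1(i),\mathbf x_2(i,j))$, formed letter by letter. The same holds for every $R$ with $0\le R<r_1(P)+r_2(P,r_1(P))$, with the roles of the two users exchanged. 3. $R^*$ is the largest sum-rate $R_1+R_2$ over all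 pairs of nonnegative rates in the union of the two superposition regions $\{R_2\le R_2'(P),\ R_1\le R_1''(P,R_2)\}$ and $\{R_1\le r_1(P),\ R_2\le r_2(P,R_1)\}$. It is at least the binning sum-rate: if $R_{1a},R_{1b},R_2\ge 0$ satisfy $R_{1a}\le R_1'(P)$, $R_{1b}+R_2\le R_2'(P)$, and $R_{1a}\le R_1''(P,R_{1b}+R_2)$ or $R_{1b}+R_2\le R_2''(P,R_{1a})$, then $R_{1a}+R_{1b}+R_2\le R^*$. -/

import Mathlib

open Filter Topology

noncomputable section

namespace Mismatch

/-! ### Distributions on finite sets and information measures (logarithms to base 2) -/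

section Information

variable {Ω A B C : Type*} [Fintype Ω] [Fintype A] [Fintype B] [Fintype C]

open Classical in
/-- The distribution of the random variable `U : Ω → A` when the sample space carries the p.m.f.
`P`; marginals are the laws of the coordinate projections. -/
def law (P : Ω → ℝ) (U : Ω → A) : A → ℝ :=
  fun a => ∑ w, if U w = a then P w else 0

/-- Shannon entropy of a p.m.f., in bits. -/
def entropy (p : A → ℝ) : ℝ := (∑ a, Real.negMulLog (p a)) / Real.log 2

/-- `I_P(U;V) = H(U) + H(V) - H(U,V)`. -/
def mutualInfo (P : Ω → ℝ) (U : Ω → A) (V : Ω → B) : ℝ :=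
  entropy (law P U) + entropy (law P V) - entropy (law P fun w => (U w, V w))

/-- `I_P(U;V|T) = H(U,T) + H(V,T) - H(T) - H(U,V,T)`. -/
def condMutualInfo (P : Ω → ℝ) (U : Ω → A) (V : Ω → B) (T : Ω → C) : ℝ :=
  entropy (law P fun w => (U w, T w)) + entropy (law P fun w => (V w, T w))
    - entropy (law P T) - entropy (law P fun w => (U w, V w, T w))

/-- `|x|^+ = max {0, x}`. -/
def plusPart (x : ℝ) : ℝ := max 0 x

end Information

/-! ### The sets of p.m.f.s and the rate functions -/

section Rates

variable {X₁ X₂ Y : Type*} [Fintype X₁] [Fintype X₂] [Fintype Y]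

/-- The coordinates `X₁`, `X₂`, `Y` on the sample space `X₁ × X₂ × Y`. -/
def rvX₁ (w : X₁ × X₂ × Y) : X₁ := w.1

def rvX₂ (w : X₁ × X₂ × Y) : X₂ := w.2.1

def rvY (w : X₁ × X₂ × Y) : Y := w.2.2

/-- Pairing of random variables. -/
def pair {Ω A B : Type*} (U : Ω → A) (V : Ω → B) (w : Ω) : A × B := (U w, V w)

/-- Expectation of a function under a p.m.f. -/
def expect {Ω : Type*} [Fintype Ω] (P : Ω → ℝ) (g : Ω → ℝ) : ℝ := ∑ w, P w * g w

/-- `𝒦(Q)`: p.m.f.s with the same `(X₁, X₂)`-marginal as `Q`. -/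
def setK (Q : X₁ × X₂ × Y → ℝ) : Set (X₁ × X₂ × Y → ℝ) :=
  {f | f ∈ stdSimplex ℝ (X₁ × X₂ × Y) ∧ law f (pair rvX₁ rvX₂) = law Q (pair rvX₁ rvX₂)}

/-- `𝒢_q(Q)`: members of `𝒦(Q)` whose expected metric is at least that of `Q`. -/
def setG (q : X₁ × X₂ × Y → ℝ) (Q : X₁ × X₂ × Y → ℝ) : Set (X₁ × X₂ × Y → ℝ) :=
  {f | f ∈ setK Q ∧ expect Q q ≤ expect f q}

/-- `ℒ₁(Q)`: members of `𝒢_q(Q)` with the same `(X₂, Y)`-marginal as `Q`. -/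
def setL₁ (q : X₁ × X₂ × Y → ℝ) (Q : X₁ × X₂ × Y → ℝ) : Set (X₁ × X₂ × Y → ℝ) :=
  {f | f ∈ setG q Q ∧ law f (pair rvX₂ rvY) = law Q (pair rvX₂ rvY)}

/-- `ℒ₂(Q)`: members of `𝒢_q(Q)` with the same `(X₁, Y)`-marginal as `Q`. -/
def setL₂ (q : X₁ × X₂ × Y → ℝ) (Q : X₁ × X₂ × Y → ℝ) : Set (X₁ × X₂ × Y → ℝ) :=
  {f | f ∈ setG q Q ∧ law f (pair rvX₁ rvY) = law Q (pair rvX₁ rvY)}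

/-- `ℒ₀(Q)`: members of `𝒢_q(Q)` with the same `Y`-marginal as `Q`. -/
def setL₀ (q : X₁ × X₂ × Y → ℝ) (Q : X₁ × X₂ × Y → ℝ) : Set (X₁ × X₂ × Y → ℝ) :=
  {f | f ∈ setG q Q ∧ law f rvY = law Q rvY}

/-- The minimum of `F` over `S`. It is used below for continuous nonnegative or bounded `F` on
compact sets `S` that contain the p.m.f. `P`, where the infimum is a minimum. -/
def minOver {α : Type*} (S : Set α) (F : α → ℝ) : ℝ := sInf (F '' S)

/-- `R₁'(P) = min_{ℒ₁(P)} I(X₁; Y, X₂)`. -/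
def R₁' (q P : X₁ × X₂ × Y → ℝ) : ℝ :=
  minOver (setL₁ q P) fun f => mutualInfo f rvX₁ (pair rvY rvX₂)

/-- `R₂'(P) = min_{ℒ₂(P)} I(X₂; Y | X₁)`. -/
def R₂' (q P : X₁ × X₂ × Y → ℝ) : ℝ :=
  minOver (setL₂ q P) fun f => condMutualInfo f rvX₂ rvY rvX₁

/-- `R₁''(P, R₂) = min_{ℒ₀(P)} { I(X₁; Y) + |I(X₂; Y | X₁) - R₂|^+ }`. -/
def R₁'' (q P : X₁ × X₂ × Y → ℝ) (r : ℝ) : ℝ :=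
  minOver (setL₀ q P) fun f =>
    mutualInfo f rvX₁ rvY + plusPart (condMutualInfo f rvX₂ rvY rvX₁ - r)

/-- `R₂''(P, R₁) = min_{ℒ₀(P)} { I(X₂; Y) - I(X₂; X₁) + |I(X₁; Y, X₂) - R₁|^+ }`. -/
def R₂'' (q P : X₁ × X₂ × Y → ℝ) (r : ℝ) : ℝ :=
  minOver (setL₀ q P) fun f =>
    mutualInfo f rvX₂ rvY - mutualInfo f rvX₂ rvX₁
      + plusPart (mutualInfo f rvX₁ (pair rvY rvX₂) - r)

/-- `r₁(P) = min_{ℒ₁(P)} I(X₁; Y | X₂)`. -/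
def r₁ (q P : X₁ × X₂ × Y → ℝ) : ℝ :=
  minOver (setL₁ q P) fun f => condMutualInfo f rvX₁ rvY rvX₂

/-- `r₂(P, R₁) = min_{ℒ₀(P)} { I(X₂; Y) + |I(X₁; Y | X₂) - R₁|^+ }`. -/
def r₂ (q P : X₁ × X₂ × Y → ℝ) (r : ℝ) : ℝ :=
  minOver (setL₀ q P) fun f =>
    mutualInfo f rvX₂ rvY + plusPart (condMutualInfo f rvX₁ rvY rvX₂ - r)

/-- The superposition-coding rate region with user 2 cognitive. -/
def supRegion (q P : X₁ × X₂ × Y → ℝ) : Set (ℝ × ℝ) :=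
  {R | 0 ≤ R.1 ∧ 0 ≤ R.2 ∧ R.2 ≤ R₂' q P ∧ R.1 ≤ R₁'' q P R.2}

/-- The superposition-coding rate region with user 1 cognitive. -/
def supRegionReversed (q P : X₁ × X₂ × Y → ℝ) : Set (ℝ × ℝ) :=
  {R | 0 ≤ R.1 ∧ 0 ≤ R.2 ∧ R.1 ≤ r₁ q P ∧ R.2 ≤ r₂ q P R.1}

/-- The random-binning rate region (user 2 cognitive). -/
def binRegion (q P : X₁ × X₂ × Y → ℝ) : Set (ℝ × ℝ) :=
  {R | 0 ≤ R.1 ∧ 0 ≤ R.2 ∧ R.1 ≤ R₁' q P ∧ R.2 ≤ R₂' q P ∧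
    (R.1 ≤ R₁'' q P R.2 ∨ R.2 ≤ R₂'' q P R.1)}

/-- The random-binning rate region, enlarged by letting the cognitive encoder carry a part `R₁b`
of the rate of user 1. -/
def binRegionEnlarged (q P : X₁ × X₂ × Y → ℝ) : Set (ℝ × ℝ) :=
  {R | 0 ≤ R.2 ∧ ∃ R₁a R₁b : ℝ, 0 ≤ R₁a ∧ 0 ≤ R₁b ∧ R.1 = R₁a + R₁b ∧
    (R₁a, R₁b + R.2) ∈ binRegion q P}

end Rates

/-! ### The single-user channel with a mismatched decoder -/

section Channel

variable {X Y : Type*} [Fintype Y]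

/-- The additive decoding metric `q_n(x, y) = (1/n) ∑ₖ q(xₖ, yₖ)`. -/
def blockMetric (q : X → Y → ℝ) {n : ℕ} (x : Fin n → X) (y : Fin n → Y) : ℝ :=
  (1 / (n : ℝ)) * ∑ k, q (x k) (y k)

/-- The memoryless law `∏ₖ W(yₖ | xₖ)`. -/
def blockChannel (W : X → Y → ℝ) {n : ℕ} (x : Fin n → X) (y : Fin n → Y) : ℝ :=
  ∏ k, W (x k) (y k)

/-- The decoder, which knows the codebook `c`, decides for message `m` upon receiving `y`:
its metric strictly exceeds that of every other message. -/
def DecodesTo (q : X → Y → ℝ) {ι : Type*} {n : ℕ} (c : ι → Fin n → X) (y : Fin n → Y)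
    (m : ι) : Prop :=
  ∀ m', m' ≠ m → blockMetric q (c m') y < blockMetric q (c m) y

open Classical in
/-- Average probability of error of the codebook `c` with equiprobable messages; ties are errors. -/
def avgError (W q : X → Y → ℝ) {ι : Type*} [Fintype ι] {n : ℕ} (c : ι → Fin n → X) : ℝ :=
  (1 / (Fintype.card ι : ℝ)) *
    ∑ m, ∑ y : Fin n → Y, if DecodesTo q c y m then 0 else blockChannel W (c m) y

/-- The number of messages of a rate-`R` code of length `n`: `2^{nR}`, rounded up. -/
def numMessages (n : ℕ) (R : ℝ) : ℕ := ⌈(2 : ℝ) ^ ((n : ℝ) * R)⌉₊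

/-- The rate `R ≥ 0` is achievable for the channel `W` with decoding metric `q`. -/
def Achievable (W q : X → Y → ℝ) (R : ℝ) : Prop :=
  0 ≤ R ∧ ∃ c : (n : ℕ) → Fin (numMessages n R) → Fin n → X,
    Tendsto (fun n => avgError W q (c n)) atTop (𝓝 0)

/-- The mismatch capacity: the supremum of the achievable rates, taken in the extended reals. -/
def mismatchCapacity (W q : X → Y → ℝ) : EReal :=
  sSup ((fun R : ℝ => (R : EReal)) '' {R | Achievable W q R})

end Channel

/-! ### Superposition coding -/

section Superposition

open Classical in
/-- The empirical distribution of a sequence. -/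
def empirical {A : Type*} {n : ℕ} (x : Fin n → A) : A → ℝ :=
  fun a => (Finset.univ.filter fun k => x k = a).card / (n : ℝ)

/-- `𝒫_n(A)`: the empirical measures of order `n` on `A`. -/
def types (A : Type*) (n : ℕ) : Set (A → ℝ) := Set.range (empirical (A := A) (n := n))

/-- The type class `T(Q)` in block length `n`. -/
def typeClass {A : Type*} (n : ℕ) (Q : A → ℝ) : Set (Fin n → A) := {x | empirical x = Q}

/-- The conditional type class `T(Q | x₁)`. -/
def condTypeClass {X₁ X₂ : Type*} {n : ℕ} (Q : X₁ × X₂ → ℝ) (x₁ : Fin n → X₁) :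
    Set (Fin n → X₂) := {x₂ | empirical (fun k => (x₁ k, x₂ k)) = Q}

open Classical in
/-- The uniform p.m.f. on a finite set. -/
def unif {A : Type*} (S : Set A) (a : A) : ℝ := if a ∈ S then 1 / (S.ncard : ℝ) else 0

variable {X₁ X₂ X Y : Type*} [Fintype X₁] [Fintype X₂] [Fintype Y]

/-- The codebook of the single-user channel made of the codewords
`φ(x₁(i), x₂(i,j))`, applied letter by letter. -/
def inducedCode (φ : X₁ × X₂ → X) {n M₁ M₂ : ℕ} (x₁ : Fin M₁ → Fin n → X₁)
    (x₂ : Fin M₁ → Fin M₂ → Fin n → X₂) : Fin M₁ × Fin M₂ → Fin n → X :=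
  fun m k => φ (x₁ m.1 k, x₂ m.1 m.2 k)

/-- The average probability of error, averaged over the constant-composition superposition
ensemble (second user cognitive) with random-coding distribution `Q`: the `x₁(i)` are independent
and uniform on `T(Q_{X₁})`; given these, the `x₂(i,j)` are independent, `x₂(i,j)` being uniform on
`T(Q | x₁(i))`. -/
def superpositionError (W q : X → Y → ℝ) (φ : X₁ × X₂ → X) (n M₁ M₂ : ℕ) (Q : X₁ × X₂ → ℝ) : ℝ :=
  ∑ x₁ : Fin M₁ → Fin n → X₁, ∑ x₂ : Fin M₁ → Fin M₂ → Fin n → X₂,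
    (∏ i, unif (typeClass n (law Q Prod.fst)) (x₁ i)) *
      (∏ i, ∏ j, unif (condTypeClass Q (x₁ i)) (x₂ i j)) *
        avgError W q (inducedCode φ x₁ x₂)

/-- The rate `R` is achieved on the single-user channel `W` with metric `q` by superposition
coding with random-coding distribution `P₁₂`, the second user being the cognitive one: `R` splits
as `R₁ + R₂` and the ensemble-average error probability at rates `(R₁, R₂)` vanishes, where in
block length `n` the distribution `P₁₂` is replaced by an approximating type of order `n`. -/
def SuperpositionAchievable (W q : X → Y → ℝ) (φ : X₁ × X₂ → X) (P₁₂ : X₁ × X₂ → ℝ)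
    (R : ℝ) : Prop :=
  ∃ R₁ R₂ : ℝ, 0 ≤ R₁ ∧ 0 ≤ R₂ ∧ R = R₁ + R₂ ∧
    ∃ Q : ℕ → X₁ × X₂ → ℝ, (∀ n, 1 ≤ n → Q n ∈ types (X₁ × X₂) n) ∧
      Tendsto Q atTop (𝓝 P₁₂) ∧
      Tendsto (fun n => superpositionError W q φ n (numMessages n R₁) (numMessages n R₂) (Q n))
        atTop (𝓝 0)

/-- `P = P_{X₁,X₂} · P_{Y | φ(X₁,X₂)}`. -/
def inducedLaw (W : X → Y → ℝ) (φ : X₁ × X₂ → X) (P₁₂ : X₁ × X₂ → ℝ) : X₁ × X₂ × Y → ℝ :=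
  fun w => P₁₂ (w.1, w.2.1) * W (φ (w.1, w.2.1)) w.2.2

/-- The induced metric `q(x₁, x₂, y) = q(φ(x₁, x₂), y)`. -/
def inducedMetric (q : X → Y → ℝ) (φ : X₁ × X₂ → X) : X₁ × X₂ × Y → ℝ :=
  fun w => q (φ (w.1, w.2.1)) w.2.2

end Superposition

end Mismatch

end

open Mismatch

/-!
Codewords are chosen at random with constant composition, so every probability in the analysis is a
ratio of sizes of type classes. The class of a type `p` of order `n` has `2 ^ (n H(p))` elements up
to a polynomial factor (`ncard_typeClass_le`, `le_ncard_typeClass`), and the number of sequences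
that complete a given sequence to a given joint type is a quotient of two such sizes
(`ncard_fiber_mul_ncard_typeClass`). Hence a fresh cloud centre has a joint type `f` with the
received word with probability about `2 ^ (-n I_f(X₁; Y))`, and a fresh satellite of a given centre
with probability about `2 ^ (-n I_f(X₂; Y | X₁))`.

A competitor that beats the sent word forces the joint type of competitor and received word to lie
in `ℒ₂` (same cloud) or `ℒ₀` (another cloud) of the joint type of sent and received word. There are
polynomially many types, so union bounds over them leave the exponents of the rate functions; in
another cloud, the probability that some satellite does harm is at most `1` as well as at most the
union bound, whence the positive part (`sum_cloudWeight_metric_le`). The joint type of sent and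
received word is close to `P` by Chebyshev's inequality (`sum_blockChannel_not_mem_le`), and the
minima over `ℒ₂` and `ℒ₀` are lower semicontinuous at `P` because these sets are compact with closed
graph (`goodSet_mem_nhds`). So rates `R₂ < R₂'(P)` and `R₁ < R₁''(P, R₂)` are achieved. Some codebook
of the ensemble is as good as the average, and discarding the surplus messages that come from
rounding gives the capacity bound. The other order of the users is the same statement for the
relabelled channel.

The sum-rate statements rest on the monotonicity of `x + R₁''(P, x)` and `x + r₂(P, x)`
(`add_minOver_plusPart_mono`). For binning, `I(X₁; X₂)` is constant on `𝒢`, so the chain rule turns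
`R₁'` and `R₂''` into `r₁` and `r₂` with shifted arguments (`R₁'_eq`, `R₂''_eq`).
-/

namespace Mismatch

/-! ### Laws, entropies and nonnegativity of the information measures -/

section InformationLemmas

open scoped Classical

variable {Ω A B C : Type*} [Fintype Ω]

/-- Change of variables: integrating against the law of `U` is integrating `g ∘ U`. -/
theorem sum_law_mul [Fintype A] (P : Ω → ℝ) (U : Ω → A) (g : A → ℝ) :
    ∑ a, law P U a * g a = ∑ w, P w * g (U w) := by
  simp only [law, Finset.sum_mul, ite_mul, zero_mul]
  rw [Finset.sum_comm]
  refine Finset.sum_congr rfl fun w _ => ?_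
  simp

theorem law_law [Fintype A] (P : Ω → ℝ) (U : Ω → A) (V : A → B) : law (law P U) V = law P (V ∘ U) := by
  funext b
  have h := sum_law_mul P U (fun a => if V a = b then (1 : ℝ) else 0)
  simp only [mul_ite, mul_one, mul_zero] at h
  simpa [law] using h

theorem law_nonneg {P : Ω → ℝ} (hP : ∀ w, 0 ≤ P w) (U : Ω → A) (a : A) : 0 ≤ law P U a :=
  Finset.sum_nonneg fun w _ => by split_ifs <;> simp [hP w]

theorem law_mem_stdSimplex [Fintype A] {P : Ω → ℝ} (hP : P ∈ stdSimplex ℝ Ω) (U : Ω → A) :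
    law P U ∈ stdSimplex ℝ A := by
  refine ⟨law_nonneg hP.1 U, ?_⟩
  have h := sum_law_mul P U fun _ => (1 : ℝ)
  simp only [mul_one] at h
  rw [h, hP.2]

theorem le_law {P : Ω → ℝ} (hP : ∀ w, 0 ≤ P w) (U : Ω → A) (w : Ω) : P w ≤ law P U (U w) := by
  have h := Finset.single_le_sum (f := fun w' => if U w' = U w then P w' else 0)
    (fun w' _ => by split_ifs <;> simp [hP w']) (Finset.mem_univ w)
  simpa [law] using h

theorem law_comp_injective (P : Ω → ℝ) (U : Ω → A) {e : A → B} (he : e.Injective) (a : A) :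
    law P (fun w => e (U w)) (e a) = law P U a := by
  simp [law, he.eq_iff]

theorem law_equiv [Fintype C] (P : Ω → ℝ) (s : Ω ≃ C) (U : Ω → A) : law (P ∘ s.symm) (U ∘ s.symm) = law P U := by
  funext a
  exact Fintype.sum_equiv s.symm _ _ fun w => rfl

theorem sum_law_pair [Fintype A] (P : Ω → ℝ) (U : Ω → A) (T : Ω → C) (s : C) :
    ∑ u, law P (fun w => (U w, T w)) (u, s) = law P T s := by
  simp only [law, Prod.mk.injEq]
  rw [Finset.sum_comm]
  refine Finset.sum_congr rfl fun w _ => ?_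
  by_cases h : T w = s <;> simp [h]

theorem entropy_law [Fintype A] (P : Ω → ℝ) (U : Ω → A) :
    entropy (law P U) = -(∑ w, P w * Real.log (law P U (U w))) / Real.log 2 := by
  rw [entropy, ← sum_law_mul P U fun a => Real.log (law P U a), ← Finset.sum_neg_distrib]
  simp [Real.negMulLog]

/-- Entropy does not see an injective relabelling of the random variable. -/
theorem entropy_law_comp_injective [Fintype A] [Fintype B] (P : Ω → ℝ) (U : Ω → A) {e : A → B} (he : e.Injective) :
    entropy (law P fun w => e (U w)) = entropy (law P U) := by
  rw [entropy_law, entropy_law]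
  simp only [law_comp_injective P U he]

theorem entropy_law_const [Fintype C] {P : Ω → ℝ} (hP : P ∈ stdSimplex ℝ Ω) (c : C) :
    entropy (law P fun _ => c) = 0 := by
  have h : law P (fun _ => c) c = 1 := by simp [law, hP.2]
  rw [entropy_law]
  simp only [h, Real.log_one, mul_zero, Finset.sum_const_zero, neg_zero, zero_div]

theorem continuous_law (U : Ω → A) : Continuous fun P : Ω → ℝ => law P U := by
  refine continuous_pi fun a => continuous_finsetSum _ fun w _ => ?_
  split_ifs
  · exact continuous_apply w
  · exact continuous_const

theorem continuous_entropy [Fintype A] : Continuous (entropy : (A → ℝ) → ℝ) := by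
  refine Continuous.div_const (continuous_finsetSum _ fun a _ => ?_) _
  exact Real.continuous_negMulLog.comp (continuous_apply a)

theorem continuous_mutualInfo [Fintype A] [Fintype B] (U : Ω → A) (V : Ω → B) :
    Continuous fun P : Ω → ℝ => mutualInfo P U V :=
  ((continuous_entropy.comp (continuous_law U)).add (continuous_entropy.comp (continuous_law V))).sub
    (continuous_entropy.comp (continuous_law _))

theorem continuous_condMutualInfo [Fintype A] [Fintype B] [Fintype C]
    (U : Ω → A) (V : Ω → B) (T : Ω → C) :
    Continuous fun P : Ω → ℝ => condMutualInfo P U V T :=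
  (((continuous_entropy.comp (continuous_law _)).add (continuous_entropy.comp (continuous_law _))).sub
    (continuous_entropy.comp (continuous_law T))).sub (continuous_entropy.comp (continuous_law _))

theorem continuous_expect (g : Ω → ℝ) : Continuous fun P : Ω → ℝ => expect P g :=
  continuous_finsetSum _ fun w _ => (continuous_apply w).mul continuous_const

/-- Conditional mutual information is nonnegative (Gibbs' inequality, from `log x ≤ x - 1`). -/
theorem condMutualInfo_nonneg [Fintype A] [Fintype B] [Fintype C]
    {P : Ω → ℝ} (hP : P ∈ stdSimplex ℝ Ω) (U : Ω → A) (V : Ω → B)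
    (T : Ω → C) : 0 ≤ condMutualInfo P U V T := by
  set a := law P fun w => (U w, T w) with ha
  set b := law P fun w => (V w, T w) with hb
  set t := law P T with ht
  set c := law P fun w => (U w, V w, T w) with hc
  have ha0 : ∀ x, 0 ≤ a x := law_nonneg hP.1 _
  have hb0 : ∀ x, 0 ≤ b x := law_nonneg hP.1 _
  have ht0 : ∀ x, 0 ≤ t x := law_nonneg hP.1 _
  have hc0 : ∀ x, 0 ≤ c x := law_nonneg hP.1 _
  have key : condMutualInfo P U V T = (∑ w, P w * (Real.log (c (U w, V w, T w)) + Real.log (t (T w))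
      - Real.log (a (U w, T w)) - Real.log (b (V w, T w)))) / Real.log 2 := by
    simp only [condMutualInfo, entropy_law, mul_add, mul_sub, Finset.sum_add_distrib,
      Finset.sum_sub_distrib]
    ring
  rw [key]
  refine div_nonneg ?_ (Real.log_nonneg one_le_two)
  have h1 : ∀ w, P w - P w * (a (U w, T w) * b (V w, T w) / (c (U w, V w, T w) * t (T w))) ≤
      P w * (Real.log (c (U w, V w, T w)) + Real.log (t (T w))
      - Real.log (a (U w, T w)) - Real.log (b (V w, T w))) := by
    intro w
    rcases (hP.1 w).eq_or_lt with h | h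
    · simp [← h]
    have hap : 0 < a (U w, T w) := h.trans_le (le_law hP.1 (fun w => (U w, T w)) w)
    have hbp : 0 < b (V w, T w) := h.trans_le (le_law hP.1 (fun w => (V w, T w)) w)
    have htp : 0 < t (T w) := h.trans_le (le_law hP.1 T w)
    have hcp : 0 < c (U w, V w, T w) := h.trans_le (le_law hP.1 (fun w => (U w, V w, T w)) w)
    have hl := Real.log_le_sub_one_of_pos
      (show 0 < a (U w, T w) * b (V w, T w) / (c (U w, V w, T w) * t (T w)) by positivity)
    rw [Real.log_div (by positivity) (by positivity), Real.log_mul hap.ne' hbp.ne',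
      Real.log_mul hcp.ne' htp.ne'] at hl
    nlinarith
  refine le_trans ?_ (Finset.sum_le_sum fun w _ => h1 w)
  rw [Finset.sum_sub_distrib, hP.2, sub_nonneg]
  have h2 : ∑ w, P w * (a (U w, T w) * b (V w, T w) / (c (U w, V w, T w) * t (T w))) =
      ∑ x : A × B × C, c x * (a (x.1, x.2.2) * b (x.2.1, x.2.2) / (c x * t x.2.2)) :=
    (sum_law_mul P (fun w => (U w, V w, T w))
      (fun x => a (x.1, x.2.2) * b (x.2.1, x.2.2) / (c x * t x.2.2))).symm
  have h3 : ∀ x : A × B × C, c x * (a (x.1, x.2.2) * b (x.2.1, x.2.2) / (c x * t x.2.2)) ≤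
      a (x.1, x.2.2) * b (x.2.1, x.2.2) / t x.2.2 := by
    intro x
    rcases (hc0 x).eq_or_lt with h | h
    · rw [← h, zero_mul]
      exact div_nonneg (mul_nonneg (ha0 _) (hb0 _)) (ht0 _)
    · apply le_of_eq
      field_simp
  rw [h2]
  refine (Finset.sum_le_sum fun x _ => h3 x).trans ?_
  have h4 : ∑ x : A × B × C, a (x.1, x.2.2) * b (x.2.1, x.2.2) / t x.2.2 =
      ∑ s, (∑ u, a (u, s)) * (∑ v, b (v, s)) / t s := by
    simp only [Fintype.sum_prod_type, Finset.sum_mul_sum, Finset.sum_div]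
    rw [Finset.sum_comm' (t' := Finset.univ) (s' := fun _ => Finset.univ) (by simp)]
    conv_lhs => enter [2, v]; rw [Finset.sum_comm]
    rw [Finset.sum_comm]
    exact Finset.sum_congr rfl fun s _ => Finset.sum_comm
  rw [h4, ← (law_mem_stdSimplex hP T).2]
  refine Finset.sum_le_sum fun s _ => ?_
  rw [ha, hb, sum_law_pair, sum_law_pair]
  exact (mul_self_div_self (t s)).le

theorem mutualInfo_nonneg [Fintype A] [Fintype B] {P : Ω → ℝ} (hP : P ∈ stdSimplex ℝ Ω) (U : Ω → A) (V : Ω → B) :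
    0 ≤ mutualInfo P U V := by
  have h := condMutualInfo_nonneg hP U V fun _ => ()
  have h1 := entropy_law_comp_injective P U (e := fun a => (a, ())) fun _ _ h => (Prod.ext_iff.1 h).1
  have h2 := entropy_law_comp_injective P V (e := fun a => (a, ())) fun _ _ h => (Prod.ext_iff.1 h).1
  have h3 := entropy_law_comp_injective P (fun w => (U w, V w)) (e := fun a => (a.1, a.2, ()))
    fun x y h => by simpa [Prod.ext_iff] using h
  rw [condMutualInfo, h1, h2, h3, entropy_law_const hP] at h
  rw [mutualInfo]
  linarith

theorem mutualInfo_comm [Fintype A] [Fintype B] (P : Ω → ℝ) (U : Ω → A) (V : Ω → B) :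
    mutualInfo P U V = mutualInfo P V U := by
  have h := entropy_law_comp_injective P (fun w => (U w, V w)) Prod.swap_injective
  change entropy (law P fun w => (V w, U w)) = _ at h
  rw [mutualInfo, mutualInfo, h]
  ring

/-- The chain rule `I(U; V, T) = I(U; T) + I(U; V | T)`. -/
theorem mutualInfo_pair [Fintype A] [Fintype B] [Fintype C]
    (P : Ω → ℝ) (U : Ω → A) (V : Ω → B) (T : Ω → C) :
    mutualInfo P U (pair V T) = mutualInfo P U T + condMutualInfo P U V T := by
  simp only [mutualInfo, condMutualInfo, pair]
  change _ + entropy (law P fun w => (V w, T w)) - _ = _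
  ring

/-- The mutual information of `U` and `V` depends on their joint law only. -/
theorem mutualInfo_eq_of_law_pair_eq [Fintype A] [Fintype B] {P P' : Ω → ℝ} {U : Ω → A} {V : Ω → B}
    (h : law P (pair U V) = law P' (pair U V)) : mutualInfo P U V = mutualInfo P' U V := by
  have h1 : law P U = law P' U := by
    have := congrArg (fun p => law p Prod.fst) h
    simpa only [law_law, Function.comp_def, pair] using this
  have h2 : law P V = law P' V := by
    have := congrArg (fun p => law p Prod.snd) h
    simpa only [law_law, Function.comp_def, pair] using this
  change law P (fun w => (U w, V w)) = law P' (fun w => (U w, V w)) at h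
  rw [mutualInfo, mutualInfo, h1, h2, h]

end InformationLemmas

/-! ### Indicators and finite product distributions -/

section Indicator

open Classical in
/-- The indicator of a proposition, as a real number. -/
noncomputable def ind (p : Prop) : ℝ := if p then 1 else 0

theorem ind_of_true {p : Prop} (h : p) : ind p = 1 := if_pos h

theorem ind_of_false {p : Prop} (h : ¬p) : ind p = 0 := if_neg h

theorem ind_nonneg (p : Prop) : 0 ≤ ind p := by
  unfold ind
  split_ifs <;> norm_num

theorem ind_le_one (p : Prop) : ind p ≤ 1 := by
  unfold ind
  split_ifs <;> norm_num

theorem ind_mono {p p' : Prop} (h : p → p') : ind p ≤ ind p' := by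
  by_cases hp : p
  · rw [ind_of_true hp, ind_of_true (h hp)]
  · rw [ind_of_false hp]
    exact ind_nonneg p'

theorem ind_or_le (p p' : Prop) : ind (p ∨ p') ≤ ind p + ind p' := by
  by_cases hp : p
  · rw [ind_of_true hp]
    linarith [ind_le_one (p ∨ p'), ind_nonneg p']
  · rw [ind_of_false hp, zero_add]
    exact ind_mono fun h => h.resolve_left hp

/-- The union bound. -/
theorem ind_exists_le {ι : Type*} (s : Finset ι) (p : ι → Prop) :
    ind (∃ i ∈ s, p i) ≤ ∑ i ∈ s, ind (p i) := by
  by_cases h : ∃ i ∈ s, p i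
  · obtain ⟨i, hi, hp⟩ := h
    calc ind (∃ i ∈ s, p i) ≤ ind (p i) := ind_mono fun _ => hp
      _ ≤ _ := Finset.single_le_sum (f := fun i => ind (p i)) (fun i _ => ind_nonneg _) hi
  · rw [ind_of_false h]
    exact Finset.sum_nonneg fun i _ => ind_nonneg _

end Indicator

section ProductWeights

variable {ι α : Type*} [Fintype ι] [DecidableEq ι] [Fintype α]

theorem sum_prod_eq_one {w : ι → α → ℝ} (hw : ∀ i, ∑ a, w i a = 1) :
    ∑ x : ι → α, ∏ i, w i (x i) = 1 := by
  classical
  rw [← Fintype.piFinset_univ, Finset.sum_prod_piFinset Finset.univ w]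
  simp [hw]

theorem sum_mul_le_of_forall_le {w F : α → ℝ} (hw : ∀ a, 0 ≤ w a) (hs : ∑ a, w a = 1) {b : ℝ}
    (h : ∀ a, w a ≠ 0 → F a ≤ b) : ∑ a, w a * F a ≤ b := by
  calc ∑ a, w a * F a ≤ ∑ a, w a * b := Finset.sum_le_sum fun a _ => by
        by_cases h0 : w a = 0
        · simp [h0]
        · exact mul_le_mul_of_nonneg_left (h a h0) (hw a)
    _ = b := by rw [← Finset.sum_mul, hs, one_mul]

theorem exists_le_of_sum_mul_le {w F : α → ℝ} (hw : ∀ a, 0 ≤ w a) (hs : ∑ a, w a = 1) {b : ℝ}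
    (h : ∑ a, w a * F a ≤ b) : ∃ a, w a ≠ 0 ∧ F a ≤ b := by
  by_contra! hc
  obtain ⟨a₀, ha₀⟩ : ∃ a, w a ≠ 0 := by
    by_contra! h0
    simp [h0] at hs
  refine h.not_gt ?_
  calc b = ∑ a, w a * b := by rw [← Finset.sum_mul, hs, one_mul]
    _ < ∑ a, w a * F a := Finset.sum_lt_sum (fun a _ => by
        by_cases h0 : w a = 0
        · simp [h0]
        · exact mul_le_mul_of_nonneg_left (hc a h0).le (hw a))
        ⟨a₀, Finset.mem_univ _, mul_lt_mul_of_pos_left (hc a₀ ha₀) ((hw a₀).lt_of_ne' ha₀)⟩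

/-- Under a product distribution, a coordinate may be replaced by an independent fresh copy
without changing the expectation. -/
theorem sum_prod_mul_resample {w : ι → α → ℝ} (i : ι) (hw : ∑ a, w i a = 1) (F : (ι → α) → ℝ) :
    ∑ x : ι → α, (∏ k, w k (x k)) * F x =
      ∑ x : ι → α, (∏ k, w k (x k)) * ∑ a, w i a * F (Function.update x i a) := by
  have hprod : ∀ (x : ι → α) (a : α),
      w i (x i) * ∏ k, w k (Function.update x i a k) = w i a * ∏ k, w k (x k) := by
    intro x a
    rw [← Finset.mul_prod_erase Finset.univ (fun k => w k (x k)) (Finset.mem_univ i),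
      ← Finset.mul_prod_erase Finset.univ (fun k => w k (Function.update x i a k))
        (Finset.mem_univ i), Function.update_self]
    rw [Finset.prod_congr rfl fun k hk => by
      rw [Function.update_of_ne (Finset.ne_of_mem_erase hk)]]
    ring
  -- exchanging the fresh copy with the coordinate is an involution that preserves the weights
  let s : (ι → α) × α ≃ (ι → α) × α :=
    { toFun := fun p => (Function.update p.1 i p.2, p.1 i)
      invFun := fun p => (Function.update p.1 i p.2, p.1 i)
      left_inv := fun p => by simp
      right_inv := fun p => by simp }
  calc ∑ x : ι → α, (∏ k, w k (x k)) * F x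
      = ∑ p : (ι → α) × α, w i p.2 * (∏ k, w k (p.1 k)) * F p.1 := by
        rw [Fintype.sum_prod_type]
        refine Finset.sum_congr rfl fun x _ => ?_
        change _ = ∑ y, w i y * (∏ k, w k (x k)) * F x
        rw [← Finset.sum_mul, ← Finset.sum_mul, hw, one_mul]
    _ = ∑ p : (ι → α) × α, w i p.2 * (∏ k, w k (p.1 k)) * F (Function.update p.1 i p.2) := by
        refine Fintype.sum_equiv s _ _ fun p => ?_
        simp only [s, Equiv.coe_fn_mk, Function.update_idem, Function.update_eq_self]
        rw [hprod]
    _ = _ := by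
        rw [Fintype.sum_prod_type]
        refine Finset.sum_congr rfl fun x _ => ?_
        rw [Finset.mul_sum]
        exact Finset.sum_congr rfl fun a _ => by ring

theorem sum_prod_mul_apply {w : ι → α → ℝ} (hw : ∀ i, ∑ a, w i a = 1) (i : ι) (g : α → ℝ) :
    ∑ x : ι → α, (∏ k, w k (x k)) * g (x i) = ∑ a, w i a * g a := by
  rw [sum_prod_mul_resample i (hw i)]
  simp only [Function.update_self]
  rw [← Finset.sum_mul, sum_prod_eq_one hw, one_mul]

/-- The variance of an average of independent variables bounded by `1` is at most `1 / n`. -/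
theorem sum_prod_mul_sq_average_le {n : ℕ} (hn : 1 ≤ n) {w : Fin n → α → ℝ}
    (hw : ∀ i, w i ∈ stdSimplex ℝ α) {g : Fin n → α → ℝ} (hg : ∀ i a, |g i a| ≤ 1) :
    ∑ x : Fin n → α, (∏ k, w k (x k)) *
      ((1 / (n : ℝ)) * ∑ k, g k (x k) - (1 / (n : ℝ)) * ∑ k, ∑ a, w k a * g k a) ^ 2
        ≤ 1 / (n : ℝ) := by
  set m : Fin n → ℝ := fun k => ∑ a, w k a * g k a with hm
  set h : Fin n → α → ℝ := fun k a => g k a - m k with hh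
  have hw1 : ∀ i, ∑ a, w i a = 1 := fun i => (hw i).2
  have hmean : ∀ k, ∑ a, w k a * h k a = 0 := fun k => by
    simp only [hh, mul_sub, Finset.sum_sub_distrib, ← Finset.sum_mul, hw1, one_mul]
    simp [hm]
  have hvar : ∀ k, ∑ a, w k a * h k a ^ 2 ≤ 1 := fun k => by
    have e : ∑ a, w k a * h k a ^ 2 = ∑ a, w k a * g k a ^ 2 - m k ^ 2 := by
      have : ∀ a, w k a * h k a ^ 2 = w k a * g k a ^ 2 - 2 * m k * (w k a * g k a)
          + m k ^ 2 * w k a := fun a => by simp only [hh]; ring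
      simp only [this, Finset.sum_add_distrib, Finset.sum_sub_distrib, ← Finset.mul_sum, hw1]
      simp only [hm]
      ring
    have : ∑ a, w k a * g k a ^ 2 ≤ 1 := sum_mul_le_of_forall_le (hw k).1 (hw1 k) fun a _ => by
      have := hg k a
      rw [← sq_abs]
      exact pow_le_one₀ (abs_nonneg _) this
    nlinarith [sq_nonneg (m k)]
  have hcross : ∀ k l, ∑ x : Fin n → α, (∏ i, w i (x i)) * (h k (x k) * h l (x l)) ≤
      if k = l then 1 else 0 := by
    intro k l
    split_ifs with hkl
    · subst hkl
      rw [sum_prod_mul_apply hw1 k fun a => h k a * h k a]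
      simpa only [sq] using hvar k
    · rw [sum_prod_mul_resample k (hw1 k)]
      simp only [Function.update_self, Function.update_of_ne (Ne.symm hkl), ← mul_assoc,
        ← Finset.sum_mul, hmean]
      simp
  have hn0 : (0 : ℝ) < n := by exact_mod_cast hn
  calc ∑ x : Fin n → α, (∏ k, w k (x k)) *
      ((1 / (n : ℝ)) * ∑ k, g k (x k) - (1 / (n : ℝ)) * ∑ k, m k) ^ 2
      = (1 / (n : ℝ)) ^ 2 *
          ∑ k, ∑ l, ∑ x : Fin n → α, (∏ i, w i (x i)) * (h k (x k) * h l (x l)) := by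
        have e : ∀ x : Fin n → α, ((1 / (n : ℝ)) * ∑ k, g k (x k) - (1 / (n : ℝ)) * ∑ k, m k) ^ 2 =
            (1 / (n : ℝ)) ^ 2 * ∑ k, ∑ l, h k (x k) * h l (x l) := fun x => by
          rw [← Finset.sum_mul_sum, ← mul_sub, mul_pow, ← Finset.sum_sub_distrib]
          simp only [hh, sq]
        simp only [e]
        rw [Finset.sum_congr rfl fun k _ => Finset.sum_comm, Finset.sum_comm, Finset.mul_sum]
        refine Finset.sum_congr rfl fun x _ => ?_
        simp only [Finset.mul_sum]
        refine Finset.sum_congr rfl fun k _ => Finset.sum_congr rfl fun l _ => ?_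
        ring
    _ ≤ (1 / (n : ℝ)) ^ 2 * ∑ k : Fin n, ∑ l, if k = l then 1 else 0 := by
        gcongr with k _ l _
        exact hcross k l
    _ = 1 / (n : ℝ) := by
        simp
        field_simp

end ProductWeights

/-! ### The method of types -/

section Types

open scoped Classical

variable {A B C Ω : Type*} {n : ℕ}

theorem empirical_eq_law (x : Fin n → A) : empirical x = law (fun _ => 1 / (n : ℝ)) x := by
  funext a
  simp [empirical, law, ← Finset.sum_filter, div_eq_mul_inv]

theorem empirical_apply (x : Fin n → A) (a : A) :
    empirical x a = ({k | x k = a}.ncard : ℝ) / n := by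
  rw [empirical, Set.ncard_eq_toFinset_card']
  simp

theorem law_empirical [Fintype A] (x : Fin n → A) (U : A → B) :
    law (empirical x) U = empirical (U ∘ x) := by
  rw [empirical_eq_law, law_law, ← empirical_eq_law]

theorem empirical_mem_stdSimplex [Fintype A] (hn : 1 ≤ n) (x : Fin n → A) :
    empirical x ∈ stdSimplex ℝ A := by
  rw [empirical_eq_law]
  refine law_mem_stdSimplex ⟨fun _ => by positivity, ?_⟩ x
  have : (n : ℝ) ≠ 0 := by exact_mod_cast (by omega : n ≠ 0)
  simp [this]

theorem expect_empirical [Fintype A] (x : Fin n → A) (g : A → ℝ) :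
    expect (empirical x) g = (1 / (n : ℝ)) * ∑ k, g (x k) := by
  rw [expect, empirical_eq_law, sum_law_mul, Finset.mul_sum]

theorem empirical_comp_perm (x : Fin n → A) (σ : Equiv.Perm (Fin n)) :
    empirical (x ∘ σ) = empirical x := by
  rw [empirical_eq_law, empirical_eq_law]
  exact law_equiv (fun _ : Fin n => 1 / (n : ℝ)) σ.symm x

theorem ncard_fiber_eq {x x' : Fin n → A} (h : empirical x = empirical x') (a : A) :
    {k | x k = a}.ncard = {k | x' k = a}.ncard := by
  rcases Nat.eq_zero_or_pos n with rfl | hn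
  · congr 1
    ext k
    exact k.elim0
  have h' := congrFun h a
  rw [empirical_apply, empirical_apply] at h'
  have : (n : ℝ) ≠ 0 := by exact_mod_cast hn.ne'
  field_simp at h'
  exact_mod_cast h'

/-- Sequences of the same type are permutations of each other. -/
theorem exists_perm_of_empirical_eq {x x' : Fin n → A} (h : empirical x = empirical x') :
    ∃ σ : Equiv.Perm (Fin n), x' = x ∘ σ := by
  have e : ∀ a, Nonempty ({k // x' k = a} ≃ {k // x k = a}) := fun a =>
    ⟨Fintype.equivOfCardEq (by
      rw [← Nat.card_eq_fintype_card, ← Nat.card_eq_fintype_card]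
      exact (ncard_fiber_eq h a).symm)⟩
  refine ⟨((Equiv.sigmaFiberEquiv x').symm.trans
    (Equiv.sigmaCongrRight fun a => (e a).some)).trans (Equiv.sigmaFiberEquiv x), ?_⟩
  funext k
  exact (((e (x' k)).some ⟨k, rfl⟩).2).symm

theorem ncard_eq_sum_ncard_fiber {α β : Type*} [Fintype α] [Fintype β] (S : Set α) (T : Set β)
    (π : α → β) (hπ : ∀ a ∈ S, π a ∈ T) {N : ℕ} (hN : ∀ b ∈ T, {a | a ∈ S ∧ π a = b}.ncard = N) :
    S.ncard = T.ncard * N := by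
  have h := Finset.card_eq_sum_card_fiberwise (f := π) (s := S.toFinset) (t := T.toFinset)
    (fun a ha => by simpa using hπ a (by simpa using ha))
  rw [Set.ncard_eq_toFinset_card' S, Set.ncard_eq_toFinset_card' T, h, Finset.sum_const_nat]
  intro b hb
  rw [← hN b (by simpa using hb), Set.ncard_eq_toFinset_card']
  congr 1
  ext a
  simp

/-- A type class is an orbit of the symmetric group; this is the orbit-stabilizer formula. -/
theorem ncard_typeClass_mul_prod_factorial [Fintype A] (x : Fin n → A) :
    (typeClass n (empirical x)).ncard * ∏ a, ({k | x k = a}.ncard).factorial = n.factorial := by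
  rw [← DomMulAct.stabilizer_ncard x]
  have h := ncard_eq_sum_ncard_fiber (Set.univ : Set (Equiv.Perm (Fin n)))
    (typeClass n (empirical x)) (fun σ => x ∘ σ) (fun σ _ => empirical_comp_perm x σ)
    (N := {σ : Equiv.Perm (Fin n) | x ∘ σ = x}.ncard) fun y hy => by
      obtain ⟨τ, rfl⟩ := exists_perm_of_empirical_eq (x := x) (x' := y) (Eq.symm hy)
      rw [← Set.ncard_image_of_injective {σ : Equiv.Perm (Fin n) | x ∘ σ = x}
        (mul_left_injective τ)]
      congr 1
      ext σ
      simp only [Set.mem_univ, true_and, Set.mem_ofPred_eq, Set.mem_image]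
      constructor
      · intro hσ
        refine ⟨σ * τ⁻¹, ?_, by simp⟩
        funext k
        have := congrFun hσ (τ⁻¹ k)
        simpa using this
      · rintro ⟨ρ, hρ, rfl⟩
        funext k
        exact congrFun hρ (τ k)
  rw [← h, Set.ncard_univ, Nat.card_eq_fintype_card, Fintype.card_perm, Fintype.card_fin]

/-- Sequences of a given type with a prescribed image under `π`: by permutation symmetry their
number does not depend on the prescribed image, whence it is a quotient of type class sizes. -/
theorem ncard_fiber_mul_ncard_typeClass [Fintype Ω] [Fintype A] (z : Fin n → Ω) (π : Ω → A) :
    {z' : Fin n → Ω | empirical z' = empirical z ∧ π ∘ z' = π ∘ z}.ncard *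
      (typeClass n (empirical (π ∘ z))).ncard = (typeClass n (empirical z)).ncard := by
  rw [mul_comm]
  refine (ncard_eq_sum_ncard_fiber (typeClass n (empirical z)) (typeClass n (empirical (π ∘ z)))
    (fun z' => π ∘ z') (fun z' hz' => ?_) fun y hy => ?_).symm
  · have h : empirical z' = empirical z := hz'
    change empirical (π ∘ z') = empirical (π ∘ z)
    rw [← law_empirical, ← law_empirical, h]
  · obtain ⟨τ, rfl⟩ := exists_perm_of_empirical_eq (x := π ∘ z) (x' := y) (Eq.symm hy)
    rw [← Set.ncard_image_of_injective {z' : Fin n → Ω | empirical z' = empirical z ∧ π ∘ z' = π ∘ z}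
      (f := fun z' => z' ∘ τ) (fun a b hab => by
        funext k
        simpa using congrFun hab (τ⁻¹ k))]
    congr 1
    ext z'
    simp only [Set.mem_ofPred_eq, Set.mem_image, typeClass]
    constructor
    · rintro ⟨h1, h2⟩
      refine ⟨z' ∘ ⇑(τ⁻¹), ⟨by rw [empirical_comp_perm, h1], ?_⟩, ?_⟩
      · funext k
        have := congrFun h2 (τ⁻¹ k)
        simpa using this
      · funext k
        simp
    · rintro ⟨y, ⟨h1, h2⟩, rfl⟩
      refine ⟨by rw [empirical_comp_perm, h1], ?_⟩
      funext k
      exact congrFun h2 (τ k)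

theorem prod_comp_eq_prod_pow [Fintype A] {M : Type*} [CommMonoid M] (x : Fin n → A) (f : A → M) :
    ∏ k, f (x k) = ∏ a, f a ^ {k | x k = a}.ncard := by
  rw [← Finset.prod_fiberwise' Finset.univ x f]
  refine Finset.prod_congr rfl fun a _ => ?_
  rw [Finset.prod_const, Set.ncard_eq_toFinset_card']
  congr 2
  ext k
  simp

/-- `c! c^k ≤ k! c^c`, the one-letter form of the fact that a multinomial distribution is maximal
at its mean. -/
theorem factorial_mul_pow_le (c k : ℕ) : c.factorial * c ^ k ≤ k.factorial * c ^ c := by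
  rcases le_total c k with h | h
  · calc c.factorial * c ^ k = (c.factorial * c ^ (k - c)) * c ^ c := by
          rw [mul_assoc, ← pow_add, Nat.sub_add_cancel h]
      _ ≤ _ := Nat.mul_le_mul_right _ (Nat.factorial_mul_pow_sub_le_factorial h)
  · calc c.factorial * c ^ k ≤ (k.factorial * c ^ (c - k)) * c ^ k := by
          refine Nat.mul_le_mul_right _ ?_
          have := Nat.factorial_mul_descFactorial (n := c) (k := c - k) (by omega)
          rw [Nat.sub_sub_self h] at this
          rw [← this]
          exact Nat.mul_le_mul_left _ (Nat.descFactorial_le_pow _ _)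
      _ = _ := by rw [mul_assoc, ← pow_add, Nat.sub_add_cancel h]

/-- Under the memoryless law with letter weights proportional to the type of `x`, no type class is
more likely than that of `x`. -/
theorem ncard_typeClass_mul_prod_le [Fintype A] (x x' : Fin n → A) :
    (typeClass n (empirical x')).ncard * ∏ k, {j | x j = x' k}.ncard ≤
      (typeClass n (empirical x)).ncard * ∏ k, {j | x j = x k}.ncard := by
  rw [prod_comp_eq_prod_pow x' fun a => {j | x j = a}.ncard,
    prod_comp_eq_prod_pow x fun a => {j | x j = a}.ncard]
  have h1 := ncard_typeClass_mul_prod_factorial x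
  have h2 := ncard_typeClass_mul_prod_factorial x'
  set N := (typeClass n (empirical x)).ncard
  set N' := (typeClass n (empirical x')).ncard
  have h3 : ∏ a, ({k | x k = a}.ncard).factorial * {k | x k = a}.ncard ^ {k | x' k = a}.ncard ≤
      ∏ a, ({k | x' k = a}.ncard).factorial * {k | x k = a}.ncard ^ {k | x k = a}.ncard :=
    Finset.prod_le_prod' fun a _ => factorial_mul_pow_le _ _
  rw [Finset.prod_mul_distrib, Finset.prod_mul_distrib] at h3
  set c := ∏ a, ({k | x k = a}.ncard).factorial
  set c' := ∏ a, ({k | x' k = a}.ncard).factorial with hc'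
  have hpos : 0 < c' := Finset.prod_pos fun a _ => Nat.factorial_pos _
  refine le_of_mul_le_mul_left (a := c') ?_ hpos
  calc c' * (N' * ∏ a, {k | x k = a}.ncard ^ {k | x' k = a}.ncard)
      = N * (c * ∏ a, {k | x k = a}.ncard ^ {k | x' k = a}.ncard) := by
        rw [← mul_assoc, mul_comm c', h2, ← h1, mul_assoc]
    _ ≤ N * (c' * ∏ a, {k | x k = a}.ncard ^ {k | x k = a}.ncard) := Nat.mul_le_mul_left _ h3
    _ = _ := by ring

/-- There are at most `(n + 1) ^ |A|` types of order `n`. -/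
theorem card_image_empirical_le {ι : Type*} [Fintype ι] [Fintype A] (e : ι → Fin n → A) :
    (Finset.univ.image fun i => empirical (e i)).card ≤ (n + 1) ^ Fintype.card A := by
  have hlt : ∀ (x : Fin n → A) a, {k | x k = a}.ncard < n + 1 := fun x a => by
    have := Set.ncard_le_card {k | x k = a}
    rw [Nat.card_eq_fintype_card, Fintype.card_fin] at this
    omega
  have : (Finset.univ.image fun i => empirical (e i)) ⊆
      (Finset.univ : Finset (A → Fin (n + 1))).image fun c a => ((c a : ℕ) : ℝ) / n := by
    intro f hf
    obtain ⟨i, -, rfl⟩ := Finset.mem_image.1 hf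
    refine Finset.mem_image.2 ⟨fun a => ⟨_, hlt (e i) a⟩, Finset.mem_univ _, ?_⟩
    funext a
    rw [empirical_apply]
  refine (Finset.card_le_card this).trans (Finset.card_image_le.trans ?_)
  simp

/-- A sum over sequences is at most the number of types times its largest part on a type class. -/
theorem sum_le_of_forall_type {ι : Type*} [Fintype ι] [Fintype A] (e : ι → Fin n → A) (g : ι → ℝ)
    {b : ℝ} (hb : 0 ≤ b)
    (h : ∀ i₀, ∑ i, g i * ind (empirical (e i) = empirical (e i₀)) ≤ b) :
    ∑ i, g i ≤ ((n : ℝ) + 1) ^ Fintype.card A * b := by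
  rw [← Finset.sum_fiberwise_of_maps_to (s := Finset.univ)
    (t := Finset.univ.image fun i => empirical (e i)) (g := fun i => empirical (e i))
    (fun i hi => Finset.mem_image_of_mem _ hi) g]
  calc _ ≤ ∑ f ∈ Finset.univ.image fun i => empirical (e i), b := Finset.sum_le_sum fun f hf => by
        obtain ⟨i₀, -, rfl⟩ := Finset.mem_image.1 hf
        rw [Finset.sum_filter]
        refine le_trans (le_of_eq (Finset.sum_congr rfl fun i _ => ?_)) (h i₀)
        split_ifs with hi
        · rw [ind_of_true hi, mul_one]
        · rw [ind_of_false hi, mul_zero]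
    _ ≤ _ := by
        rw [Finset.sum_const, nsmul_eq_mul]
        refine mul_le_mul_of_nonneg_right ?_ hb
        exact_mod_cast card_image_empirical_le e

theorem prod_empirical_eq [Fintype A] (hn : 1 ≤ n) (x : Fin n → A) :
    ∏ k, empirical x (x k) = (2 : ℝ) ^ (-(n * entropy (empirical x))) := by
  have hn0 : (n : ℝ) ≠ 0 := by exact_mod_cast (by omega : n ≠ 0)
  have hpos : ∀ k, 0 < empirical x (x k) := fun k => by
    rw [empirical_eq_law]
    exact lt_of_lt_of_le (by positivity) (le_law (fun _ => by positivity) x k)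
  have h := entropy_law (fun _ : Fin n => 1 / (n : ℝ)) x
  rw [← empirical_eq_law, ← Finset.mul_sum] at h
  rw [h, Real.rpow_def_of_pos two_pos, ← Real.exp_log (Finset.prod_pos fun k _ => hpos k),
    Real.log_prod fun k _ => (hpos k).ne']
  have : Real.log 2 ≠ 0 := (Real.log_pos one_lt_two).ne'
  congr 1
  field_simp

theorem sum_prod_empirical [Fintype A] (hn : 1 ≤ n) (x : Fin n → A) :
    ∑ x' : Fin n → A, ∏ k, empirical x (x' k) = 1 :=
  sum_prod_eq_one (w := fun _ : Fin n => empirical x) fun _ => (empirical_mem_stdSimplex hn x).2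

theorem sum_prod_on_typeClass [Fintype A] (x' : Fin n → A) (p : A → ℝ) :
    ∑ y : Fin n → A, (∏ k, p (y k)) * ind (empirical y = empirical x') =
      (typeClass n (empirical x')).ncard * ∏ k, p (x' k) := by
  have : ∀ y : Fin n → A, (∏ k, p (y k)) * ind (empirical y = empirical x') =
      if empirical y = empirical x' then ∏ k, p (x' k) else 0 := fun y => by
    split_ifs with h
    · rw [ind_of_true h, mul_one]
      obtain ⟨σ, rfl⟩ := exists_perm_of_empirical_eq h
      exact (Equiv.prod_comp σ fun k => p (y k)).symm
    · rw [ind_of_false h, mul_zero]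
  rw [Finset.sum_congr rfl fun y _ => this y, ← Finset.sum_filter, Finset.sum_const, nsmul_eq_mul,
    Set.ncard_eq_toFinset_card']
  congr 3
  ext y
  rw [Finset.mem_filter, Set.mem_toFinset]
  exact and_iff_right (Finset.mem_univ y)

theorem ncard_typeClass_le [Fintype A] (hn : 1 ≤ n) (x : Fin n → A) :
    ((typeClass n (empirical x)).ncard : ℝ) ≤ (2 : ℝ) ^ (n * entropy (empirical x)) := by
  have h0 : ∀ y : Fin n → A, 0 ≤ ∏ k, empirical x (y k) := fun y =>
    Finset.prod_nonneg fun k _ => (empirical_mem_stdSimplex hn x).1 _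
  have h := sum_prod_on_typeClass x (empirical x)
  rw [prod_empirical_eq hn] at h
  have h2 : ((typeClass n (empirical x)).ncard : ℝ) * (2 : ℝ) ^ (-(n * entropy (empirical x))) ≤ 1 := by
    rw [← h, ← sum_prod_empirical hn x]
    exact Finset.sum_le_sum fun y _ => mul_le_of_le_one_right (h0 y) (ind_le_one _)
  rwa [Real.rpow_neg two_pos.le, ← div_eq_mul_inv, div_le_one (by positivity)] at h2

theorem le_ncard_typeClass [Fintype A] (hn : 1 ≤ n) (x : Fin n → A) :
    (2 : ℝ) ^ (n * entropy (empirical x)) ≤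
      ((n : ℝ) + 1) ^ Fintype.card A * (typeClass n (empirical x)).ncard := by
  have hmode : ∀ x' : Fin n → A,
      ((typeClass n (empirical x')).ncard : ℝ) * ∏ k, empirical x (x' k) ≤
        (typeClass n (empirical x)).ncard * ∏ k, empirical x (x k) := by
    intro x'
    have h := ncard_typeClass_mul_prod_le x x'
    simp only [empirical_apply x, Finset.prod_div_distrib, ← mul_div_assoc]
    refine div_le_div_of_nonneg_right ?_ (by positivity)
    exact_mod_cast h
  have h := sum_le_of_forall_type (fun y : Fin n → A => y) (fun y => ∏ k, empirical x (y k))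
    (b := (typeClass n (empirical x)).ncard * ∏ k, empirical x (x k))
    (mul_nonneg (Nat.cast_nonneg _)
      (Finset.prod_nonneg fun k _ => (empirical_mem_stdSimplex hn x).1 _))
    (fun x' => (sum_prod_on_typeClass x' _).le.trans (hmode x'))
  rw [sum_prod_empirical hn, prod_empirical_eq hn, Real.rpow_neg two_pos.le, ← mul_assoc,
    ← div_eq_mul_inv, le_div_iff₀ (by positivity), one_mul] at h
  exact h

end Types

/-! ### Probabilities of joint types under constant-composition sampling -/

section JointTypes

open scoped Classical

variable {A B C : Type*} {n : ℕ}

theorem unif_nonneg (S : Set A) (a : A) : 0 ≤ unif S a := by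
  unfold unif
  split_ifs <;> positivity

theorem sum_unif [Fintype A] {S : Set A} (hS : S.Nonempty) : ∑ a, unif S a = 1 := by
  have hpos : (0 : ℝ) < S.ncard := by exact_mod_cast (Set.ncard_pos (Set.toFinite S)).2 hS
  simp only [unif, ← Finset.sum_filter, Finset.sum_const, nsmul_eq_mul]
  rw [Set.ncard_eq_toFinset_card'] at hpos ⊢
  have : (Finset.univ.filter fun a => a ∈ S) = S.toFinset := by ext; simp
  rw [this]
  field_simp

theorem mem_of_unif_ne_zero {S : Set A} {a : A} (h : unif S a ≠ 0) : a ∈ S := by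
  by_contra hc
  exact h (if_neg hc)

/-- If `S` contains the event `E`, then the uniform probability of `E` is `|E| / |S|`. -/
theorem sum_unif_mul_indicator [Fintype A] {S E : Set A} (hE : E ⊆ S) :
    ∑ a, unif S a * ind (a ∈ E) = (E.ncard : ℝ) / S.ncard := by
  have : ∀ a, unif S a * ind (a ∈ E) = if a ∈ E then 1 / (S.ncard : ℝ) else 0 := by
    intro a
    by_cases ha : a ∈ E
    · rw [ind_of_true ha]
      simp [ha, unif, hE ha]
    · rw [ind_of_false ha]
      simp [ha]
  rw [Finset.sum_congr rfl fun a _ => this a, ← Finset.sum_filter, Finset.sum_const, nsmul_eq_mul,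
    Set.ncard_eq_toFinset_card' E]
  have : (Finset.univ.filter fun a => a ∈ E) = E.toFinset := by ext; simp
  rw [this]
  ring

theorem typeClass_ncard_pos [Fintype A] (x : Fin n → A) :
    0 < (typeClass n (empirical x)).ncard :=
  (Set.ncard_pos (Set.toFinite _)).2 ⟨x, rfl⟩

/-- The number of sequences with a given joint type with a fixed sequence. -/
theorem ncard_joint_mul [Fintype A] [Fintype B] (u : Fin n → A) (v : Fin n → B) :
    {u' : Fin n → A | empirical (fun k => (u' k, v k)) = empirical fun k => (u k, v k)}.ncard *
      (typeClass n (empirical v)).ncard =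
        (typeClass n (empirical fun k => (u k, v k))).ncard := by
  rw [← ncard_fiber_mul_ncard_typeClass (fun k => (u k, v k)) Prod.snd,
    ← Set.ncard_image_of_injective {u' : Fin n → A | _} (f := fun u' k => (u' k, v k))
      (fun a b h => funext fun k => (Prod.ext_iff.1 (congrFun h k)).1)]
  congr 2
  ext z
  simp only [Set.mem_image, Set.mem_ofPred_eq]
  constructor
  · rintro ⟨u', h, rfl⟩
    exact ⟨h, rfl⟩
  · rintro ⟨h1, h2⟩
    have h3 : (fun k => ((z k).1, v k)) = z := funext fun k =>
      Prod.ext rfl (congrFun h2 k).symm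
    exact ⟨fun k => (z k).1, by rw [h3, h1], h3⟩

theorem empirical_comp_eq_iff [Fintype A] {e : A → B} (he : e.Injective) (x x' : Fin n → A) :
    empirical (fun k => e (x k)) = empirical (fun k => e (x' k)) ↔ empirical x = empirical x' := by
  constructor
  · intro h
    funext a
    have := congrFun h (e a)
    rwa [empirical_eq_law, empirical_eq_law, law_comp_injective _ _ he, law_comp_injective _ _ he,
      ← empirical_eq_law, ← empirical_eq_law] at this
  · intro h
    change empirical (e ∘ x) = empirical (e ∘ x')
    rw [← law_empirical, ← law_empirical, h]

theorem entropy_empirical_comp [Fintype A] [Fintype B] {e : A → B} (he : e.Injective)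
    (x : Fin n → A) : entropy (empirical fun k => e (x k)) = entropy (empirical x) := by
  rw [empirical_eq_law, entropy_law_comp_injective _ _ he, ← empirical_eq_law]

/-- A sequence drawn uniformly from the type class of `u` has the joint type of `(u, v)` with `v`
with probability at most `2 ^ {-n I}`, up to a polynomial factor. -/
theorem sum_unif_typeClass_le [Fintype A] [Fintype B] (hn : 1 ≤ n) (u : Fin n → A) (v : Fin n → B) :
    ∑ u', unif (typeClass n (empirical u)) u' *
      ind (empirical (fun k => (u' k, v k)) = empirical fun k => (u k, v k)) ≤
    ((n : ℝ) + 1) ^ (Fintype.card A + Fintype.card B) *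
      (2 : ℝ) ^ (-(n * mutualInfo (empirical fun k => (u k, v k)) Prod.fst Prod.snd)) := by
  have hsub : {u' : Fin n → A | empirical (fun k => (u' k, v k)) = empirical fun k => (u k, v k)} ⊆
      typeClass n (empirical u) := fun u' (h : empirical _ = empirical _) => by
    have := congrArg (fun p => law p Prod.fst) h
    simp only [law_empirical] at this
    exact this
  have h := sum_unif_mul_indicator hsub
  simp only [Set.mem_ofPred_eq] at h
  rw [h]
  have hI : mutualInfo (empirical fun k => (u k, v k)) Prod.fst Prod.snd =
      entropy (empirical u) + entropy (empirical v) - entropy (empirical fun k => (u k, v k)) := by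
    simp only [mutualInfo, law_empirical]
    rfl
  have hnum : (({u' : Fin n → A | empirical (fun k => (u' k, v k)) =
      empirical fun k => (u k, v k)}.ncard : ℕ) : ℝ) * (typeClass n (empirical v)).ncard =
        (typeClass n (empirical fun k => (u k, v k))).ncard := by
    exact_mod_cast ncard_joint_mul u v
  have hu := le_ncard_typeClass hn u
  have hv := le_ncard_typeClass hn v
  have huv := ncard_typeClass_le hn fun k => (u k, v k)
  have pu : (0 : ℝ) < (typeClass n (empirical u)).ncard := by exact_mod_cast typeClass_ncard_pos u
  have pv : (0 : ℝ) < (typeClass n (empirical v)).ncard := by exact_mod_cast typeClass_ncard_pos v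
  set K : ℝ := (({u' : Fin n → A | empirical (fun k => (u' k, v k)) =
      empirical fun k => (u k, v k)}.ncard : ℕ) : ℝ)
  set Nu : ℝ := ((typeClass n (empirical u)).ncard : ℝ)
  set Nv : ℝ := ((typeClass n (empirical v)).ncard : ℝ)
  rw [div_le_iff₀ pu]
  refine le_of_mul_le_mul_right ?_ pv
  rw [hnum]
  refine huv.trans ?_
  have e : (2 : ℝ) ^ (n * entropy (empirical fun k => (u k, v k))) =
      2 ^ (-(n * mutualInfo (empirical fun k => (u k, v k)) Prod.fst Prod.snd)) *
        (2 ^ (n * entropy (empirical u)) * 2 ^ (n * entropy (empirical v))) := by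
    rw [← Real.rpow_add two_pos, ← Real.rpow_add two_pos, hI]
    congr 1
    ring
  rw [e]
  calc _ ≤ (2 : ℝ) ^ (-(n * mutualInfo (empirical fun k => (u k, v k)) Prod.fst Prod.snd)) *
        ((((n : ℝ) + 1) ^ Fintype.card A * Nu) * (((n : ℝ) + 1) ^ Fintype.card B * Nv)) := by
        gcongr
    _ = _ := by rw [pow_add]; ring

/-- The conditional version of `sum_unif_typeClass_le`: given `s`, a sequence drawn uniformly from
the conditional type class of `u` has the joint type of `(s, u, v)` with `(s, v)` with probability
at most `2 ^ {-n I(u; v | s)}`, up to a polynomial factor. -/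
theorem sum_unif_condTypeClass_le [Fintype A] [Fintype B] [Fintype C] (hn : 1 ≤ n)
    (s : Fin n → A) (u : Fin n → B) (v : Fin n → C) :
    ∑ u', unif (condTypeClass (empirical fun k => (s k, u k)) s) u' *
      ind (empirical (fun k => (s k, u' k, v k)) = empirical fun k => (s k, u k, v k)) ≤
    ((n : ℝ) + 1) ^ (Fintype.card A * Fintype.card B + Fintype.card A * Fintype.card C) *
      (2 : ℝ) ^ (-(n * condMutualInfo (empirical fun k => (s k, u k, v k)) rvX₂ rvY rvX₁)) := by
  have hsub : {u' : Fin n → B | empirical (fun k => (s k, u' k, v k)) =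
      empirical fun k => (s k, u k, v k)} ⊆ condTypeClass (empirical fun k => (s k, u k)) s :=
    fun u' (h : empirical _ = empirical _) => by
      have := congrArg (fun p => law p fun w => (w.1, w.2.1)) h
      simp only [law_empirical] at this
      exact this
  have h := sum_unif_mul_indicator hsub
  simp only [Set.mem_ofPred_eq] at h
  rw [h]
  have iA : Function.Injective fun p : B × A × C => (p.2.1, p.1, p.2.2) := fun x y h => by
    simp only [Prod.ext_iff] at h ⊢; tauto
  have iB : Function.Injective (Prod.swap : B × A → A × B) := Prod.swap_injective
  have iC : Function.Injective (Prod.swap : C × A → A × C) := Prod.swap_injective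
  have iD : Function.Injective fun p : B × C × A => (p.1, p.2.2, p.2.1) := fun x y h => by
    simp only [Prod.ext_iff] at h ⊢; tauto
  have hI : condMutualInfo (empirical fun k => (s k, u k, v k)) rvX₂ rvY rvX₁ =
      entropy (empirical fun k => (u k, s k)) + entropy (empirical fun k => (s k, v k))
        - entropy (empirical s) - entropy (empirical fun k => (u k, s k, v k)) := by
    have e1 : entropy (empirical fun k => (u k, s k, v k)) =
        entropy (empirical fun k => (u k, v k, s k)) :=
      entropy_empirical_comp iD fun k => (u k, v k, s k)
    have e2 : entropy (empirical fun k => (s k, v k)) = entropy (empirical fun k => (v k, s k)) :=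
      entropy_empirical_comp iC fun k => (v k, s k)
    simp only [condMutualInfo, law_empirical]
    rw [e1, e2]
    rfl
  have c1 := ncard_joint_mul u fun k => (s k, v k)
  have c2 := ncard_joint_mul u s
  have s1 : {u' : Fin n → B | empirical (fun k => (u' k, s k, v k)) =
      empirical fun k => (u k, s k, v k)} = {u' : Fin n → B |
        empirical (fun k => (s k, u' k, v k)) = empirical fun k => (s k, u k, v k)} := by
    ext u'
    exact (empirical_comp_eq_iff iA (fun k => (u' k, s k, v k)) fun k => (u k, s k, v k)).symm
  have s2 : {u' : Fin n → B | empirical (fun k => (u' k, s k)) = empirical fun k => (u k, s k)} =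
      condTypeClass (empirical fun k => (s k, u k)) s := by
    ext u'
    exact (empirical_comp_eq_iff iB (fun k => (u' k, s k)) fun k => (u k, s k)).symm
  rw [s1] at c1
  rw [s2] at c2
  set K := {u' : Fin n → B |
        empirical (fun k => (s k, u' k, v k)) = empirical fun k => (s k, u k, v k)}.ncard
  set D := (condTypeClass (empirical fun k => (s k, u k)) s).ncard
  have hsv := le_ncard_typeClass hn fun k => (s k, v k)
  have hus := le_ncard_typeClass hn fun k => (u k, s k)
  have hs := ncard_typeClass_le hn s
  have husv := ncard_typeClass_le hn fun k => (u k, s k, v k)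
  have ps := typeClass_ncard_pos s
  have psv := typeClass_ncard_pos fun k => (s k, v k)
  have pus := typeClass_ncard_pos fun k => (u k, s k)
  have pD : 0 < D := Nat.pos_of_ne_zero fun h0 => by
    rw [h0, zero_mul] at c2
    omega
  have c1' : (K : ℝ) * (typeClass n (empirical fun k => (s k, v k))).ncard =
    (typeClass n (empirical fun k => (u k, s k, v k))).ncard := by exact_mod_cast c1
  have c2' : (D : ℝ) * (typeClass n (empirical s)).ncard =
    (typeClass n (empirical fun k => (u k, s k))).ncard := by exact_mod_cast c2
  set Ns := (typeClass n (empirical s)).ncard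
  set Nsv := (typeClass n (empirical fun k => (s k, v k))).ncard
  set Nus := (typeClass n (empirical fun k => (u k, s k))).ncard
  set Nusv := (typeClass n (empirical fun k => (u k, s k, v k))).ncard
  have ps' : (0 : ℝ) < Ns := by exact_mod_cast ps
  have psv' : (0 : ℝ) < Nsv := by exact_mod_cast psv
  have pus' : (0 : ℝ) < Nus := by exact_mod_cast pus
  have pD' : (0 : ℝ) < D := by exact_mod_cast pD
  have hratio : (K : ℝ) / D = Nusv * Ns / (Nsv * Nus) := by
    rw [← c1', ← c2']
    field_simp
  rw [hratio, div_le_iff₀ (by positivity)]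
  have e : (2 : ℝ) ^ (n * entropy (empirical fun k => (u k, s k, v k))) *
      2 ^ (n * entropy (empirical s)) =
      2 ^ (-(n * condMutualInfo (empirical fun k => (s k, u k, v k)) rvX₂ rvY rvX₁)) *
        (2 ^ (n * entropy (empirical fun k => (s k, v k))) *
          2 ^ (n * entropy (empirical fun k => (u k, s k)))) := by
    rw [← Real.rpow_add two_pos, ← Real.rpow_add two_pos, ← Real.rpow_add two_pos, hI]
    congr 1
    ring
  rw [Fintype.card_prod] at hsv hus
  calc (Nusv : ℝ) * Ns ≤ 2 ^ (n * entropy (empirical fun k => (u k, s k, v k))) *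
      2 ^ (n * entropy (empirical s)) := by gcongr
    _ ≤ (2 : ℝ) ^ (-(n * condMutualInfo (empirical fun k => (s k, u k, v k)) rvX₂ rvY rvX₁)) *
        ((((n : ℝ) + 1) ^ (Fintype.card A * Fintype.card C) * Nsv) *
          (((n : ℝ) + 1) ^ (Fintype.card B * Fintype.card A) * Nus)) := by
        rw [e]
        gcongr
    _ = _ := by rw [pow_add, mul_comm (Fintype.card B)]; ring

end JointTypes

/-! ### Two-level random codebooks -/

section Clouds

variable {S T : Type*} {M₁ M₂ : ℕ}

/-- The probability of a cloud, that is of a cloud centre `c.1` together with its satellites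
`c.2 j`, when the centre has distribution `p` and the satellites are conditionally independent
with distribution `p₂ c.1`. -/
def cloudWeight (p : S → ℝ) (p₂ : S → T → ℝ) (M₂ : ℕ) (c : S × (Fin M₂ → T)) : ℝ :=
  p c.1 * ∏ j, p₂ c.1 (c.2 j)

variable {p : S → ℝ} {p₂ : S → T → ℝ}

theorem cloudWeight_nonneg (hp : ∀ s, 0 ≤ p s) (hp₂ : ∀ s t, 0 ≤ p₂ s t)
    (c : S × (Fin M₂ → T)) : 0 ≤ cloudWeight p p₂ M₂ c :=
  mul_nonneg (hp _) (Finset.prod_nonneg fun _ _ => hp₂ _ _)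

variable [Fintype S] [Fintype T]

theorem sum_cloudWeight_mul (F : S × (Fin M₂ → T) → ℝ) :
    ∑ c, cloudWeight p p₂ M₂ c * F c = ∑ s, p s * ∑ t : Fin M₂ → T, (∏ j, p₂ s (t j)) * F (s, t) := by
  rw [Fintype.sum_prod_type]
  refine Finset.sum_congr rfl fun s _ => ?_
  rw [Finset.mul_sum]
  exact Finset.sum_congr rfl fun t _ => by rw [cloudWeight, mul_assoc]

theorem sum_cloudWeight (hs : ∑ s, p s = 1) (hs₂ : ∀ s, p s ≠ 0 → ∑ t, p₂ s t = 1) :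
    ∑ c, cloudWeight p p₂ M₂ c = 1 := by
  have h := sum_cloudWeight_mul (p := p) (p₂ := p₂) (M₂ := M₂) fun _ => (1 : ℝ)
  simp only [mul_one] at h
  rw [h, ← hs]
  refine Finset.sum_congr rfl fun s _ => ?_
  by_cases h0 : p s = 0
  · simp [h0]
  · rw [sum_prod_eq_one (w := fun _ : Fin M₂ => p₂ s) fun _ => hs₂ s h0, mul_one]

/-- The union bound for a two-level random codebook. The loss of message `(i, j)` is split into
a part `G₀` that depends on the sent pair only, parts `G₁` for the satellites of its own cloud and
parts `G₂` for the other clouds; `η`, `a`, `b` bound their conditional expectations. -/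
theorem sum_clouds_mul_le (hp : ∀ s, 0 ≤ p s) (hs : ∑ s, p s = 1) (hp₂ : ∀ s t, 0 ≤ p₂ s t)
    (hs₂ : ∀ s, p s ≠ 0 → ∑ t, p₂ s t = 1) (hM₁ : 1 ≤ M₁) (hM₂ : 1 ≤ M₂)
    {G₀ : S → T → ℝ} {G₁ : S → T → T → ℝ} {G₂ : S → T → S × (Fin M₂ → T) → ℝ} {η a b : ℝ}
    (h₀ : ∀ s t, p s ≠ 0 → p₂ s t ≠ 0 → G₀ s t ≤ η)
    (h₁ : ∀ s t, p s ≠ 0 → p₂ s t ≠ 0 → ∑ t', p₂ s t' * G₁ s t t' ≤ a)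
    (h₂ : ∀ s t, p s ≠ 0 → p₂ s t ≠ 0 → ∑ c, cloudWeight p p₂ M₂ c * G₂ s t c ≤ b)
    (i : Fin M₁) (j : Fin M₂) {E : (Fin M₁ → S × (Fin M₂ → T)) → ℝ}
    (hE : ∀ C, E C ≤ G₀ (C i).1 ((C i).2 j)
      + ∑ j' ∈ Finset.univ.erase j, G₁ (C i).1 ((C i).2 j) ((C i).2 j')
      + ∑ i' ∈ Finset.univ.erase i, G₂ (C i).1 ((C i).2 j) (C i')) :
    ∑ C : Fin M₁ → S × (Fin M₂ → T), (∏ k, cloudWeight p p₂ M₂ (C k)) * E C ≤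
      η + ((M₂ : ℝ) - 1) * a + ((M₁ : ℝ) - 1) * b := by
  have w0 : ∀ c, 0 ≤ cloudWeight p p₂ M₂ c := cloudWeight_nonneg hp hp₂
  have w1 : ∑ c, cloudWeight p p₂ M₂ c = 1 := sum_cloudWeight hs hs₂
  have hsupp : ∀ c : S × (Fin M₂ → T), cloudWeight p p₂ M₂ c ≠ 0 →
      p c.1 ≠ 0 ∧ ∀ j, p₂ c.1 (c.2 j) ≠ 0 := fun c hc =>
    ⟨left_ne_zero_of_mul hc, fun j =>
      Finset.prod_ne_zero_iff.1 (right_ne_zero_of_mul hc) j (Finset.mem_univ j)⟩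
  have P0 : ∀ C : Fin M₁ → S × (Fin M₂ → T), 0 ≤ ∏ k, cloudWeight p p₂ M₂ (C k) := fun C =>
    Finset.prod_nonneg fun _ _ => w0 _
  have P1 : ∑ C : Fin M₁ → S × (Fin M₂ → T), ∏ k, cloudWeight p p₂ M₂ (C k) = 1 :=
    sum_prod_eq_one (w := fun _ : Fin M₁ => cloudWeight p p₂ M₂) fun _ => w1
  have t0 : ∑ C : Fin M₁ → S × (Fin M₂ → T), (∏ k, cloudWeight p p₂ M₂ (C k)) *
      G₀ (C i).1 ((C i).2 j) ≤ η :=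
    sum_mul_le_of_forall_le P0 P1 fun C hC => by
      have := hsupp (C i) (Finset.prod_ne_zero_iff.1 hC i (Finset.mem_univ i))
      exact h₀ _ _ this.1 (this.2 j)
  have t1 : ∀ j' ∈ Finset.univ.erase j, ∑ C : Fin M₁ → S × (Fin M₂ → T),
      (∏ k, cloudWeight p p₂ M₂ (C k)) * G₁ (C i).1 ((C i).2 j) ((C i).2 j') ≤ a := by
    intro j' hj'
    rw [sum_prod_mul_apply (w := fun _ : Fin M₁ => cloudWeight p p₂ M₂) (fun _ => w1) i
      fun c => G₁ c.1 (c.2 j) (c.2 j'), sum_cloudWeight_mul]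
    refine sum_mul_le_of_forall_le hp hs fun s hps => ?_
    rw [sum_prod_mul_resample (w := fun _ : Fin M₂ => p₂ s) j' (hs₂ s hps)]
    refine sum_mul_le_of_forall_le (fun t => Finset.prod_nonneg fun _ _ => hp₂ _ _)
      (sum_prod_eq_one (w := fun _ : Fin M₂ => p₂ s) fun _ => hs₂ s hps) fun t ht => ?_
    simp only [Function.update_self, Function.update_of_ne (Finset.ne_of_mem_erase hj').symm]
    exact h₁ s (t j) hps (Finset.prod_ne_zero_iff.1 ht j (Finset.mem_univ j))
  have t2 : ∀ i' ∈ Finset.univ.erase i, ∑ C : Fin M₁ → S × (Fin M₂ → T),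
      (∏ k, cloudWeight p p₂ M₂ (C k)) * G₂ (C i).1 ((C i).2 j) (C i') ≤ b := by
    intro i' hi'
    rw [sum_prod_mul_resample (w := fun _ : Fin M₁ => cloudWeight p p₂ M₂) i' w1]
    refine sum_mul_le_of_forall_le P0 P1 fun C hC => ?_
    simp only [Function.update_self, Function.update_of_ne (Finset.ne_of_mem_erase hi').symm]
    have := hsupp (C i) (Finset.prod_ne_zero_iff.1 hC i (Finset.mem_univ i))
    exact h₂ _ _ this.1 (this.2 j)
  calc _ ≤ ∑ C : Fin M₁ → S × (Fin M₂ → T), (∏ k, cloudWeight p p₂ M₂ (C k)) *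
        (G₀ (C i).1 ((C i).2 j)
          + ∑ j' ∈ Finset.univ.erase j, G₁ (C i).1 ((C i).2 j) ((C i).2 j')
          + ∑ i' ∈ Finset.univ.erase i, G₂ (C i).1 ((C i).2 j) (C i')) :=
        Finset.sum_le_sum fun C _ => mul_le_mul_of_nonneg_left (hE C) (P0 C)
    _ = (∑ C : Fin M₁ → S × (Fin M₂ → T), (∏ k, cloudWeight p p₂ M₂ (C k)) *
          G₀ (C i).1 ((C i).2 j))
        + (∑ j' ∈ Finset.univ.erase j, ∑ C : Fin M₁ → S × (Fin M₂ → T),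
          (∏ k, cloudWeight p p₂ M₂ (C k)) * G₁ (C i).1 ((C i).2 j) ((C i).2 j'))
        + ∑ i' ∈ Finset.univ.erase i, ∑ C : Fin M₁ → S × (Fin M₂ → T),
          (∏ k, cloudWeight p p₂ M₂ (C k)) * G₂ (C i).1 ((C i).2 j) (C i') := by
        rw [Finset.sum_comm (s := Finset.univ.erase j), Finset.sum_comm (s := Finset.univ.erase i),
          ← Finset.sum_add_distrib, ← Finset.sum_add_distrib]
        refine Finset.sum_congr rfl fun C _ => ?_
        rw [mul_add, mul_add, Finset.mul_sum, Finset.mul_sum]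
    _ ≤ η + (∑ j' ∈ Finset.univ.erase j, a) + ∑ i' ∈ Finset.univ.erase i, b :=
        add_le_add (add_le_add t0 (Finset.sum_le_sum t1)) (Finset.sum_le_sum t2)
    _ = _ := by
        rw [Finset.sum_const, Finset.sum_const, Finset.card_erase_of_mem (Finset.mem_univ _),
          Finset.card_erase_of_mem (Finset.mem_univ _)]
        simp [Nat.cast_sub hM₁, Nat.cast_sub hM₂]

/-- The probability that some satellite of a cloud lies in the event `e`, grouped by the values
of a label `l` of the satellites: given the centre, for each label it is at most the minimum of `1`
and the union bound. -/
theorem sum_prod_mul_ind_exists_le {L : Type*} [DecidableEq L] {w : T → ℝ} (hw : ∀ t, 0 ≤ w t)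
    (hs : ∑ t, w t = 1) (e : T → Prop) (l : T → L) (𝓛 : Finset L) (hl : ∀ t, l t ∈ 𝓛) :
    ∑ t : Fin M₂ → T, (∏ j, w (t j)) * ind (∃ j, e (t j)) ≤
      ∑ f ∈ 𝓛, min 1 ((M₂ : ℝ) * ∑ t, w t * ind (e t ∧ l t = f)) := by
  have W0 : ∀ t : Fin M₂ → T, 0 ≤ ∏ j, w (t j) := fun t => Finset.prod_nonneg fun _ _ => hw _
  have W1 : ∑ t : Fin M₂ → T, ∏ j, w (t j) = 1 :=
    sum_prod_eq_one (w := fun _ : Fin M₂ => w) fun _ => hs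
  calc _ ≤ ∑ t : Fin M₂ → T, (∏ j, w (t j)) * ∑ f ∈ 𝓛, ind (∃ j, e (t j) ∧ l (t j) = f) := by
        refine Finset.sum_le_sum fun t _ => mul_le_mul_of_nonneg_left ?_ (W0 t)
        refine le_trans (ind_mono ?_) (ind_exists_le 𝓛 fun f => ∃ j, e (t j) ∧ l (t j) = f)
        rintro ⟨j, hj⟩
        exact ⟨l (t j), hl _, j, hj, rfl⟩
    _ = ∑ f ∈ 𝓛, ∑ t : Fin M₂ → T, (∏ j, w (t j)) * ind (∃ j, e (t j) ∧ l (t j) = f) := by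
        rw [Finset.sum_comm]
        exact Finset.sum_congr rfl fun t _ => Finset.mul_sum _ _ _
    _ ≤ _ := by
        refine Finset.sum_le_sum fun f _ => le_min ?_ ?_
        · exact sum_mul_le_of_forall_le W0 W1 fun t _ => ind_le_one _
        · calc _ ≤ ∑ t : Fin M₂ → T, (∏ j, w (t j)) * ∑ j, ind (e (t j) ∧ l (t j) = f) := by
                refine Finset.sum_le_sum fun t _ => mul_le_mul_of_nonneg_left ?_ (W0 t)
                refine le_trans (ind_mono ?_)
                  (ind_exists_le Finset.univ fun j => e (t j) ∧ l (t j) = f)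
                rintro ⟨j, hj⟩
                exact ⟨j, Finset.mem_univ j, hj⟩
            _ = ∑ j : Fin M₂, ∑ t : Fin M₂ → T,
                (∏ j, w (t j)) * ind (e (t j) ∧ l (t j) = f) := by
                rw [Finset.sum_comm]
                exact Finset.sum_congr rfl fun t _ => Finset.mul_sum _ _ _
            _ = ∑ j : Fin M₂, ∑ t, w t * ind (e t ∧ l t = f) :=
                Finset.sum_congr rfl fun j _ => sum_prod_mul_apply (w := fun _ : Fin M₂ => w)
                  (fun _ => hs) j fun t => ind (e t ∧ l t = f)
            _ = _ := by simp

end Clouds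

/-! ### The error probability of constant-composition superposition coding -/

section RandomCoding

open scoped Classical

variable {X X₁ X₂ Y : Type*} {n : ℕ}

theorem setL₀_of_metric_le [Fintype X₁] [Fintype X₂] [Fintype Y] (hn : 1 ≤ n) (q : X → Y → ℝ)
    (φ : X₁ × X₂ → X) {s s' : Fin n → X₁} {t t' : Fin n → X₂} {y : Fin n → Y}
    (h : empirical (fun k => (s' k, t' k)) = empirical fun k => (s k, t k))
    (hq : blockMetric q (fun k => φ (s k, t k)) y ≤ blockMetric q (fun k => φ (s' k, t' k)) y) :
    empirical (fun k => (s' k, t' k, y k)) ∈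
      setL₀ (inducedMetric q φ) (empirical fun k => (s k, t k, y k)) := by
  refine ⟨⟨⟨empirical_mem_stdSimplex hn _, ?_⟩, ?_⟩, ?_⟩
  · rw [law_empirical, law_empirical]
    exact h
  · rw [expect_empirical, expect_empirical]
    exact hq
  · rw [law_empirical, law_empirical]
    rfl

/-- Competitors within the cloud of the sent message: if all of `ℒ₂` at the received joint type has
conditional information above `c`, a fresh satellite beats the sent word with probability at most
`2 ^ {-n c}`, up to a polynomial factor. -/
theorem sum_condTypeClass_metric_le [Fintype X₁] [Fintype X₂] [Fintype Y] (hn : 1 ≤ n)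
    (q : X → Y → ℝ) (φ : X₁ × X₂ → X) (s : Fin n → X₁) (t : Fin n → X₂) (y : Fin n → Y) {c : ℝ}
    (hc : ∀ f ∈ setL₂ (inducedMetric q φ) (empirical fun k => (s k, t k, y k)),
      c < condMutualInfo f rvX₂ rvY rvX₁) :
    ∑ t', unif (condTypeClass (empirical fun k => (s k, t k)) s) t' *
        ind (blockMetric q (fun k => φ (s k, t k)) y ≤ blockMetric q (fun k => φ (s k, t' k)) y) ≤
      ((n : ℝ) + 1) ^ Fintype.card (X₁ × X₂ × Y) *
        (((n : ℝ) + 1) ^ (Fintype.card X₁ * Fintype.card X₂ + Fintype.card X₁ * Fintype.card Y) *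
          (2 : ℝ) ^ (-(n * c))) := by
  refine sum_le_of_forall_type (fun t' k => (s k, t' k, y k)) _ (by positivity) fun t₀ => ?_
  -- membership in the class and the metric comparison depend on the joint type only
  by_cases h : t₀ ∈ condTypeClass (empirical fun k => (s k, t k)) s ∧
      blockMetric q (fun k => φ (s k, t k)) y ≤ blockMetric q (fun k => φ (s k, t₀ k)) y
  · have h₀ : empirical (fun k => (s k, t₀ k)) = empirical fun k => (s k, t k) := h.1
    have hL := setL₀_of_metric_le hn q φ h₀ h.2
    have hI := hc _ ⟨hL.1, by rw [law_empirical, law_empirical]; rfl⟩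
    have hb := sum_unif_condTypeClass_le hn s t₀ y
    rw [h₀] at hb
    refine le_trans (Finset.sum_le_sum fun t' _ => ?_) (hb.trans ?_)
    · exact mul_le_mul_of_nonneg_right
        (mul_le_of_le_one_right (unif_nonneg _ _) (ind_le_one _)) (ind_nonneg _)
    · have hn0 : (0 : ℝ) ≤ n := Nat.cast_nonneg n
      gcongr
      exact one_le_two
  · refine le_trans (le_of_eq (Finset.sum_eq_zero fun t' _ => ?_)) (by positivity)
    by_cases ht : empirical (fun k => (s k, t' k, y k)) = empirical fun k => (s k, t₀ k, y k)
    · rw [not_and_or] at h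
      rcases h with h | h
      · have : unif (condTypeClass (empirical fun k => (s k, t k)) s) t' = 0 := by
          refine if_neg fun hmem => h ?_
          have e := congrArg (fun p => law p fun w => (w.1, w.2.1)) ht
          simp only [law_empirical] at e
          exact e.symm.trans hmem
        rw [this, zero_mul, zero_mul]
      · have e := congrArg (fun p => expect p (inducedMetric q φ)) ht
        simp only [expect_empirical] at e
        rw [ind_of_false (p := blockMetric q (fun k => φ (s k, t k)) y ≤ _) (fun hle => h ?_),
          mul_zero, zero_mul]
        exact hle.trans (le_of_eq e)
    · rw [ind_of_false ht, mul_zero]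

theorem mul_min_one_le {N x r d : ℝ} {m : ℕ} (hN : 1 ≤ N) (hm : (m : ℝ) ≤ 2 * 2 ^ (x * r)) :
    min 1 ((m : ℝ) * (N * 2 ^ (-(x * d)))) ≤ 2 * (N * (2 : ℝ) ^ (-(x * plusPart (d - r)))) := by
  rcases le_total d r with h | h
  · have : plusPart (d - r) = 0 := max_eq_left (by linarith)
    rw [this]
    refine (min_le_left _ _).trans ?_
    simp only [mul_zero, neg_zero, Real.rpow_zero, mul_one]
    linarith
  · have : plusPart (d - r) = d - r := max_eq_right (by linarith)
    rw [this]
    refine (min_le_right _ _).trans ?_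
    have e : (2 : ℝ) ^ (-(x * (d - r))) = 2 ^ (x * r) * 2 ^ (-(x * d)) := by
      rw [← Real.rpow_add two_pos]
      congr 1
      ring
    rw [e]
    calc _ ≤ (2 * 2 ^ (x * r)) * (N * (2 : ℝ) ^ (-(x * d))) := by gcongr
      _ = _ := by ring

/-- Competitors from another cloud: a fresh cloud contains a word that beats the sent word with
probability at most `2 ^ {-n c}`, up to a polynomial factor, if all of `ℒ₀` at the received joint
type has `I(X₁; Y) + |I(X₂; Y | X₁) - r|^+` above `c`. The positive part comes from bounding the
probability that a satellite does so by the minimum of `1` and the union bound. -/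
theorem sum_cloudWeight_metric_le [Fintype X₁] [Fintype X₂] [Fintype Y] (hn : 1 ≤ n)
    (q : X → Y → ℝ) (φ : X₁ × X₂ → X) (s : Fin n → X₁) (t : Fin n → X₂) (y : Fin n → Y)
    {Q : X₁ × X₂ → ℝ} (hQ : empirical (fun k => (s k, t k)) = Q)
    (hQ₂ : ∀ s' ∈ typeClass n (law Q Prod.fst), (condTypeClass Q s').Nonempty)
    {M₂ : ℕ} {r c : ℝ} (hM₂ : (M₂ : ℝ) ≤ 2 * 2 ^ (n * r))
    (hc : ∀ f ∈ setL₀ (inducedMetric q φ) (empirical fun k => (s k, t k, y k)),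
      c < mutualInfo f rvX₁ rvY + plusPart (condMutualInfo f rvX₂ rvY rvX₁ - r)) :
    ∑ x, cloudWeight (unif (typeClass n (law Q Prod.fst))) (fun s' => unif (condTypeClass Q s'))
        M₂ x * ind (∃ j, blockMetric q (fun k => φ (s k, t k)) y ≤
          blockMetric q (fun k => φ (x.1 k, x.2 j k)) y) ≤
      2 * (((n : ℝ) + 1) ^ (Fintype.card (X₁ × X₂ × Y) +
        (Fintype.card X₁ * Fintype.card X₂ + Fintype.card X₁ * Fintype.card Y) +
        (Fintype.card X₁ + Fintype.card Y)) * (2 : ℝ) ^ (-(n * c))) := by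
  set K := Fintype.card X₁ * Fintype.card X₂ + Fintype.card X₁ * Fintype.card Y with hK
  set N : ℝ := ((n : ℝ) + 1) with hN
  have hN1 : 1 ≤ N := by simp [hN]
  set p := unif (typeClass n (law Q Prod.fst)) with hp
  have p0 : ∀ s', 0 ≤ p s' := unif_nonneg _
  set bad : (Fin n → X₁) → (Fin n → X₂) → Prop := fun s' t' =>
    blockMetric q (fun k => φ (s k, t k)) y ≤ blockMetric q (fun k => φ (s' k, t' k)) y
  set 𝓛 := Finset.univ.image fun z : (Fin n → X₁) × (Fin n → X₂) =>
    empirical fun k => (z.1 k, z.2 k, y k)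
  set g : (X₁ × X₂ × Y → ℝ) → (Fin n → X₁) → ℝ := fun f s' =>
    ∑ t', unif (condTypeClass Q s') t' *
      ind (bad s' t' ∧ empirical (fun k => (s' k, t' k, y k)) = f)
  have step : ∀ f ∈ 𝓛, ∑ s', p s' * min 1 ((M₂ : ℝ) * g f s') ≤
      2 * (N ^ (K + (Fintype.card X₁ + Fintype.card Y)) * (2 : ℝ) ^ (-(n * c))) := by
    intro f _
    by_cases hex : ∃ s₀ t₀, p s₀ ≠ 0 ∧ unif (condTypeClass Q s₀) t₀ ≠ 0 ∧ bad s₀ t₀ ∧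
        empirical (fun k => (s₀ k, t₀ k, y k)) = f
    · obtain ⟨s₀, t₀, hps, hpt, hb, rfl⟩ := hex
      have hs₀ : empirical s₀ = law Q Prod.fst :=
        mem_of_unif_ne_zero (S := typeClass n (law Q Prod.fst)) hps
      have ht₀ : empirical (fun k => (s₀ k, t₀ k)) = Q :=
        mem_of_unif_ne_zero (S := condTypeClass Q s₀) hpt
      have hI := hc _ (setL₀_of_metric_le hn q φ (ht₀.trans hQ.symm) hb)
      set f := empirical fun k => (s₀ k, t₀ k, y k) with hf
      set I₁ := mutualInfo f rvX₁ rvY with hI₁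
      set I₂ := condMutualInfo f rvX₂ rvY rvX₁ with hI₂
      have hgle : ∀ s', g f s' ≤ N ^ K * (2 : ℝ) ^ (-(n * I₂)) := by
        intro s'
        by_cases hex' : ∃ t₁, unif (condTypeClass Q s') t₁ ≠ 0 ∧
            empirical (fun k => (s' k, t₁ k, y k)) = f
        · obtain ⟨t₁, ht₁, hf₁⟩ := hex'
          have ht₁ : empirical (fun k => (s' k, t₁ k)) = Q :=
            mem_of_unif_ne_zero (S := condTypeClass Q s') ht₁
          have hb := sum_unif_condTypeClass_le hn s' t₁ y
          rw [ht₁, hf₁] at hb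
          refine le_trans (Finset.sum_le_sum fun t' _ => ?_) hb
          exact mul_le_mul_of_nonneg_left (ind_mono fun h => h.2) (unif_nonneg _ _)
        · push Not at hex'
          refine le_trans (le_of_eq (Finset.sum_eq_zero fun t' _ => ?_)) (by positivity)
          by_cases h0 : unif (condTypeClass Q s') t' = 0
          · rw [h0, zero_mul]
          · rw [ind_of_false fun h => hex' t' h0 h.2, mul_zero]
      have hmin : ∀ s', min 1 ((M₂ : ℝ) * g f s') ≤
          ind (empirical (fun k => (s' k, y k)) = empirical fun k => (s₀ k, y k)) *
            (2 * (N ^ K * (2 : ℝ) ^ (-(n * plusPart (I₂ - r))))) := by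
        intro s'
        by_cases hs' : empirical (fun k => (s' k, y k)) = empirical fun k => (s₀ k, y k)
        · rw [ind_of_true hs', one_mul]
          refine le_trans (min_le_min le_rfl ?_) (mul_min_one_le (one_le_pow₀ hN1) hM₂)
          exact mul_le_mul_of_nonneg_left (hgle s') (Nat.cast_nonneg _)
        · have hg0 : g f s' = 0 := by
            refine Finset.sum_eq_zero fun t' _ => ?_
            rw [ind_of_false, mul_zero]
            rintro ⟨-, h⟩
            have e := congrArg (fun p => law p fun w => (w.1, w.2.2)) h
            simp only [hf, law_empirical] at e
            exact hs' e
          rw [hg0, ind_of_false hs']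
          simp
      have hII : mutualInfo (empirical fun k => (s₀ k, y k)) Prod.fst Prod.snd = I₁ := by
        simp only [hI₁, hf, mutualInfo, law_empirical]
        rfl
      have hcount := sum_unif_typeClass_le hn s₀ y
      rw [hs₀, hII] at hcount
      calc _ ≤ ∑ s', p s' *
            (ind (empirical (fun k => (s' k, y k)) = empirical fun k => (s₀ k, y k)) *
              (2 * (N ^ K * (2 : ℝ) ^ (-(n * plusPart (I₂ - r)))))) :=
            Finset.sum_le_sum fun s' _ => mul_le_mul_of_nonneg_left (hmin s') (p0 s')
        _ = (∑ s', p s' *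
            ind (empirical (fun k => (s' k, y k)) = empirical fun k => (s₀ k, y k))) *
              (2 * (N ^ K * (2 : ℝ) ^ (-(n * plusPart (I₂ - r))))) := by
            rw [Finset.sum_mul]
            exact Finset.sum_congr rfl fun s' _ => (mul_assoc _ _ _).symm
        _ ≤ (N ^ (Fintype.card X₁ + Fintype.card Y) * (2 : ℝ) ^ (-(n * I₁))) *
              (2 * (N ^ K * (2 : ℝ) ^ (-(n * plusPart (I₂ - r))))) :=
            mul_le_mul_of_nonneg_right hcount (by positivity)
        _ = 2 * (N ^ (K + (Fintype.card X₁ + Fintype.card Y)) *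
              (2 : ℝ) ^ (-(n * (I₁ + plusPart (I₂ - r))))) := by
            rw [pow_add N K, mul_add, neg_add, Real.rpow_add two_pos]
            ring
        _ ≤ _ := by
            gcongr
            exact one_le_two
    · push Not at hex
      refine le_trans (le_of_eq (Finset.sum_eq_zero fun s' _ => ?_)) (by positivity)
      by_cases h0 : p s' = 0
      · rw [h0, zero_mul]
      · have hg0 : g f s' = 0 := by
          refine Finset.sum_eq_zero fun t' _ => ?_
          by_cases h1 : unif (condTypeClass Q s') t' = 0
          · rw [h1, zero_mul]
          · rw [ind_of_false fun h => hex s' t' h0 h1 h.1 h.2, mul_zero]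
        rw [hg0]
        simp
  rw [sum_cloudWeight_mul]
  calc _ ≤ ∑ s', p s' * ∑ f ∈ 𝓛, min 1 ((M₂ : ℝ) * g f s') := by
        refine Finset.sum_le_sum fun s' _ => ?_
        by_cases h0 : p s' = 0
        · rw [h0, zero_mul, zero_mul]
        refine mul_le_mul_of_nonneg_left ?_ (p0 s')
        exact sum_prod_mul_ind_exists_le (unif_nonneg _)
          (sum_unif (hQ₂ s' (mem_of_unif_ne_zero h0))) (bad s')
          (fun t' => empirical fun k => (s' k, t' k, y k)) 𝓛
          fun t' => Finset.mem_image.2 ⟨(s', t'), Finset.mem_univ _, rfl⟩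
    _ = ∑ f ∈ 𝓛, ∑ s', p s' * min 1 ((M₂ : ℝ) * g f s') := by
        rw [Finset.sum_comm]
        exact Finset.sum_congr rfl fun s' _ => Finset.mul_sum _ _ _
    _ ≤ 𝓛.card • (2 * (N ^ (K + (Fintype.card X₁ + Fintype.card Y)) * (2 : ℝ) ^ (-(n * c)))) :=
        Finset.sum_le_card_nsmul _ _ _ step
    _ ≤ N ^ Fintype.card (X₁ × X₂ × Y) *
        (2 * (N ^ (K + (Fintype.card X₁ + Fintype.card Y)) * (2 : ℝ) ^ (-(n * c)))) := by
        rw [nsmul_eq_mul]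
        refine mul_le_mul_of_nonneg_right ?_ (by positivity)
        have := card_image_empirical_le fun (z : (Fin n → X₁) × (Fin n → X₂)) k =>
          (z.1 k, z.2 k, y k)
        rw [hN]
        exact_mod_cast this
    _ = _ := by
        rw [pow_add N (_ + K), pow_add N _ K, pow_add N K]
        ring

theorem superpositionError_eq [Fintype X₁] [Fintype X₂] [Fintype Y] (W q : X → Y → ℝ)
    (φ : X₁ × X₂ → X) (M₁ M₂ : ℕ) (Q : X₁ × X₂ → ℝ) :
    superpositionError W q φ n M₁ M₂ Q =
      ∑ C : Fin M₁ → (Fin n → X₁) × (Fin M₂ → Fin n → X₂),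
        (∏ i, cloudWeight (unif (typeClass n (law Q Prod.fst)))
          (fun s => unif (condTypeClass Q s)) M₂ (C i)) *
          avgError W q (inducedCode φ (fun i => (C i).1) fun i => (C i).2) := by
  rw [superpositionError, ← Fintype.sum_prod_type']
  refine Fintype.sum_equiv (Equiv.arrowProdEquivProdArrow (Fin M₁) _ _).symm _ _ fun z => ?_
  simp only [cloudWeight, Finset.prod_mul_distrib]
  rfl

theorem avgError_eq [Fintype Y] (W q : X → Y → ℝ) {ι : Type*} [Fintype ι] (c : ι → Fin n → X) :
    avgError W q c = (1 / (Fintype.card ι : ℝ)) *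
      ∑ m, ∑ y, blockChannel W (c m) y * ind (¬ DecodesTo q c y m) := by
  rw [avgError]
  congr 1
  refine Finset.sum_congr rfl fun m _ => Finset.sum_congr rfl fun y _ => ?_
  by_cases h : DecodesTo q c y m
  · rw [if_pos h, ind_of_false (not_not.2 h), mul_zero]
  · rw [if_neg h, ind_of_true h, mul_one]

theorem blockChannel_nonneg [Fintype Y] {W : X → Y → ℝ} (hW : ∀ x, W x ∈ stdSimplex ℝ Y)
    (x : Fin n → X) (y : Fin n → Y) : 0 ≤ blockChannel W x y :=
  Finset.prod_nonneg fun _ _ => (hW _).1 _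

theorem sum_blockChannel [Fintype Y] {W : X → Y → ℝ} (hW : ∀ x, W x ∈ stdSimplex ℝ Y)
    (x : Fin n → X) : ∑ y, blockChannel W x y = 1 :=
  sum_prod_eq_one (w := fun k => W (x k)) fun _ => (hW _).2

theorem avgError_nonneg [Fintype Y] {W : X → Y → ℝ} (hW : ∀ x, W x ∈ stdSimplex ℝ Y)
    (q : X → Y → ℝ) {ι : Type*} [Fintype ι] (c : ι → Fin n → X) : 0 ≤ avgError W q c := by
  rw [avgError_eq]
  exact mul_nonneg (by positivity) (Finset.sum_nonneg fun m _ => Finset.sum_nonneg fun y _ =>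
    mul_nonneg (blockChannel_nonneg hW _ _) (ind_nonneg _))

end RandomCoding

section EnsembleBound

open scoped Classical

variable {X X₁ X₂ Y : Type*} [Fintype X₁] [Fintype X₂] [Fintype Y] {n : ℕ}

/-- The joint distributions at which the information quantities that govern competitors in the
cloud of the sent word exceed `c₂` and those that govern the other clouds exceed `c₁`. -/
def goodSet (q : X₁ × X₂ × Y → ℝ) (r c₁ c₂ : ℝ) : Set (X₁ × X₂ × Y → ℝ) :=
  {P | (∀ f ∈ setL₂ q P, c₂ < condMutualInfo f rvX₂ rvY rvX₁) ∧
    ∀ f ∈ setL₀ q P, c₁ < mutualInfo f rvX₁ rvY + plusPart (condMutualInfo f rvX₂ rvY rvX₁ - r)}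

theorem condTypeClass_nonempty {Q : X₁ × X₂ → ℝ} (hQ : Q ∈ types (X₁ × X₂) n) {s : Fin n → X₁}
    (hs : s ∈ typeClass n (law Q Prod.fst)) : (condTypeClass Q s).Nonempty := by
  obtain ⟨z, rfl⟩ := hQ
  have hs' : empirical (Prod.fst ∘ z) = empirical s := by
    rw [← law_empirical]
    exact Eq.symm hs
  obtain ⟨σ, rfl⟩ := exists_perm_of_empirical_eq hs'
  exact ⟨Prod.snd ∘ z ∘ σ, empirical_comp_perm z σ⟩

theorem typeClass_fst_nonempty {Q : X₁ × X₂ → ℝ} (hQ : Q ∈ types (X₁ × X₂) n) :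
    (typeClass n (law Q Prod.fst)).Nonempty := by
  obtain ⟨z, rfl⟩ := hQ
  exact ⟨Prod.fst ∘ z, (law_empirical z Prod.fst).symm⟩

/-- A bound on the ensemble-average error probability in terms of the probability `η` of receiving
a bad joint type; the two other terms are union bounds over the words of the cloud of the sent word
and over the other clouds. -/
theorem superpositionError_le (hn : 1 ≤ n) {W : X → Y → ℝ} (hW : ∀ x, W x ∈ stdSimplex ℝ Y)
    (q : X → Y → ℝ) (φ : X₁ × X₂ → X) {Q : X₁ × X₂ → ℝ} (hQ : Q ∈ types (X₁ × X₂) n)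
    {M₁ M₂ : ℕ} (hM₁ : 1 ≤ M₁) (hM₂ : 1 ≤ M₂) {r c₁ c₂ η : ℝ}
    (hM₂r : (M₂ : ℝ) ≤ 2 * 2 ^ (n * r))
    (hη : ∀ (s : Fin n → X₁) (t : Fin n → X₂), empirical (fun k => (s k, t k)) = Q →
      ∑ y, blockChannel W (fun k => φ (s k, t k)) y *
        ind (empirical (fun k => (s k, t k, y k)) ∉ goodSet (inducedMetric q φ) r c₁ c₂) ≤ η) :
    superpositionError W q φ n M₁ M₂ Q ≤ η +
      ((M₂ : ℝ) - 1) * (((n : ℝ) + 1) ^ Fintype.card (X₁ × X₂ × Y) *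
        (((n : ℝ) + 1) ^ (Fintype.card X₁ * Fintype.card X₂ + Fintype.card X₁ * Fintype.card Y) *
          (2 : ℝ) ^ (-(n * c₂)))) +
      ((M₁ : ℝ) - 1) * (2 * (((n : ℝ) + 1) ^ (Fintype.card (X₁ × X₂ × Y) +
        (Fintype.card X₁ * Fintype.card X₂ + Fintype.card X₁ * Fintype.card Y) +
        (Fintype.card X₁ + Fintype.card Y)) * (2 : ℝ) ^ (-(n * c₁)))) := by
  set U := goodSet (inducedMetric q φ) r c₁ c₂ with hU
  set a : ℝ := ((n : ℝ) + 1) ^ Fintype.card (X₁ × X₂ × Y) *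
        (((n : ℝ) + 1) ^ (Fintype.card X₁ * Fintype.card X₂ + Fintype.card X₁ * Fintype.card Y) *
          (2 : ℝ) ^ (-(n * c₂))) with ha
  set b : ℝ := 2 * (((n : ℝ) + 1) ^ (Fintype.card (X₁ × X₂ × Y) +
        (Fintype.card X₁ * Fintype.card X₂ + Fintype.card X₁ * Fintype.card Y) +
        (Fintype.card X₁ + Fintype.card Y)) * (2 : ℝ) ^ (-(n * c₁))) with hb
  have a0 : 0 ≤ a := by positivity
  have b0 : 0 ≤ b := by positivity
  set p := unif (typeClass n (law Q Prod.fst)) with hp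
  set p₂ : (Fin n → X₁) → (Fin n → X₂) → ℝ := fun s => unif (condTypeClass Q s) with hp₂
  set V : (Fin n → X₁) → (Fin n → X₂) → (Fin n → Y) → ℝ := fun s t y =>
    blockChannel W (fun k => φ (s k, t k)) y with hV
  have V0 : ∀ s t y, 0 ≤ V s t y := fun s t y => blockChannel_nonneg hW _ _
  have V1 : ∀ s t, ∑ y, V s t y = 1 := fun s t => sum_blockChannel hW _
  set T : (Fin n → X₁) → (Fin n → X₂) → (Fin n → Y) → X₁ × X₂ × Y → ℝ := fun s t y =>
    empirical fun k => (s k, t k, y k) with hT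
  set bad : (Fin n → X₁) → (Fin n → X₂) → (Fin n → Y) → (Fin n → X₁) → (Fin n → X₂) → Prop :=
    fun s t y s' t' =>
      blockMetric q (fun k => φ (s k, t k)) y ≤ blockMetric q (fun k => φ (s' k, t' k)) y with hbad
  have hmem : ∀ s t, p₂ s t ≠ 0 → empirical (fun k => (s k, t k)) = Q := fun s t h =>
    mem_of_unif_ne_zero (S := condTypeClass Q s) h
  have hsum₂ : ∀ s, p s ≠ 0 → ∑ t, p₂ s t = 1 := fun s h =>
    sum_unif (condTypeClass_nonempty hQ (mem_of_unif_ne_zero (S := typeClass n _) h))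
  have key : ∀ (i : Fin M₁) (j : Fin M₂),
      ∑ C : Fin M₁ → (Fin n → X₁) × (Fin M₂ → Fin n → X₂), (∏ k, cloudWeight p p₂ M₂ (C k)) *
        ∑ y, blockChannel W (inducedCode φ (fun i => (C i).1) (fun i => (C i).2) (i, j)) y *
          ind (¬ DecodesTo q (inducedCode φ (fun i => (C i).1) fun i => (C i).2) y (i, j)) ≤
      η + ((M₂ : ℝ) - 1) * a + ((M₁ : ℝ) - 1) * b := by
    intro i j
    refine sum_clouds_mul_le (G₀ := fun s t => ∑ y, V s t y * ind (T s t y ∉ U))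
      (G₁ := fun s t t' => ∑ y, V s t y * ind (T s t y ∈ U ∧ bad s t y s t'))
      (G₂ := fun s t x => ∑ y, V s t y * ind (T s t y ∈ U ∧ ∃ j', bad s t y x.1 (x.2 j')))
      (unif_nonneg _) (sum_unif (typeClass_fst_nonempty hQ)) (fun s => unif_nonneg _) hsum₂ hM₁ hM₂
      (fun s t _ ht => hη s t (hmem s t ht)) ?_ ?_ i j ?_
    · intro s t _ ht
      have e : ∑ t', p₂ s t' * ∑ y, V s t y * ind (T s t y ∈ U ∧ bad s t y s t') =
          ∑ y, V s t y * ∑ t', p₂ s t' * ind (T s t y ∈ U ∧ bad s t y s t') := by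
        simp only [Finset.mul_sum]
        rw [Finset.sum_comm]
        exact Finset.sum_congr rfl fun y _ => Finset.sum_congr rfl fun t' _ => by ring
      rw [e]
      refine sum_mul_le_of_forall_le (V0 s t) (V1 s t) fun y _ => ?_
      by_cases hTU : T s t y ∈ U
      · have h := sum_condTypeClass_metric_le hn q φ s t y hTU.1
        rw [hmem s t ht] at h
        refine le_trans (Finset.sum_le_sum fun t' _ => ?_) h
        exact mul_le_mul_of_nonneg_left (ind_mono fun h => h.2) (unif_nonneg _ _)
      · refine le_trans (le_of_eq (Finset.sum_eq_zero fun t' _ => ?_)) a0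
        rw [ind_of_false fun h => hTU h.1, mul_zero]
    · intro s t _ ht
      have e : ∑ x, cloudWeight p p₂ M₂ x *
          ∑ y, V s t y * ind (T s t y ∈ U ∧ ∃ j', bad s t y x.1 (x.2 j')) =
          ∑ y, V s t y * ∑ x, cloudWeight p p₂ M₂ x *
            ind (T s t y ∈ U ∧ ∃ j', bad s t y x.1 (x.2 j')) := by
        simp only [Finset.mul_sum]
        rw [Finset.sum_comm]
        exact Finset.sum_congr rfl fun y _ => Finset.sum_congr rfl fun t' _ => by ring
      rw [e]
      refine sum_mul_le_of_forall_le (V0 s t) (V1 s t) fun y _ => ?_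
      by_cases hTU : T s t y ∈ U
      · have h := sum_cloudWeight_metric_le hn q φ s t y (hmem s t ht)
          (fun s' hs' => condTypeClass_nonempty hQ hs') hM₂r hTU.2
        refine le_trans (Finset.sum_le_sum fun x _ => ?_) h
        exact mul_le_mul_of_nonneg_left (ind_mono fun h => h.2)
          (cloudWeight_nonneg (unif_nonneg _) (fun s => unif_nonneg _) x)
      · refine le_trans (le_of_eq (Finset.sum_eq_zero fun x _ => ?_)) b0
        rw [ind_of_false fun h => hTU h.1, mul_zero]
    · intro C
      set s := (C i).1 with hs
      set t := (C i).2 j with ht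
      have hsplit : ∀ y, ind (¬ DecodesTo q (inducedCode φ (fun i => (C i).1) fun i => (C i).2) y
            (i, j)) ≤ ind (T s t y ∉ U)
          + ∑ j' ∈ Finset.univ.erase j, ind (T s t y ∈ U ∧ bad s t y s ((C i).2 j'))
          + ∑ i' ∈ Finset.univ.erase i,
            ind (T s t y ∈ U ∧ ∃ j', bad s t y (C i').1 ((C i').2 j')) := by
        intro y
        refine le_trans (ind_mono (p' := (T s t y ∉ U ∨
          ∃ j' ∈ Finset.univ.erase j, T s t y ∈ U ∧ bad s t y s ((C i).2 j')) ∨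
          ∃ i' ∈ Finset.univ.erase i, T s t y ∈ U ∧ ∃ j', bad s t y (C i').1 ((C i').2 j')) ?_) ?_
        · intro hD
          by_cases hTU : T s t y ∈ U
          · rw [DecodesTo] at hD
            push Not at hD
            obtain ⟨⟨i', j'⟩, hne, hle⟩ := hD
            by_cases hi : i' = i
            · subst hi
              refine Or.inl (Or.inr ⟨j', ?_, hTU, hle⟩)
              exact Finset.mem_erase.2 ⟨fun hj => hne (by rw [hj]), Finset.mem_univ _⟩
            · exact Or.inr ⟨i', Finset.mem_erase.2 ⟨hi, Finset.mem_univ _⟩, hTU, j', hle⟩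
          · exact Or.inl (Or.inl hTU)
        · refine (ind_or_le _ _).trans (add_le_add ((ind_or_le _ _).trans (add_le_add le_rfl ?_)) ?_)
          · exact ind_exists_le (Finset.univ.erase j) fun j' =>
              T s t y ∈ U ∧ bad s t y s ((C i).2 j')
          · exact ind_exists_le (Finset.univ.erase i) fun i' =>
              T s t y ∈ U ∧ ∃ j', bad s t y (C i').1 ((C i').2 j')
      calc _ ≤ ∑ y, V s t y * (ind (T s t y ∉ U)
          + ∑ j' ∈ Finset.univ.erase j, ind (T s t y ∈ U ∧ bad s t y s ((C i).2 j'))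
          + ∑ i' ∈ Finset.univ.erase i,
            ind (T s t y ∈ U ∧ ∃ j', bad s t y (C i').1 ((C i').2 j'))) :=
            Finset.sum_le_sum fun y _ => mul_le_mul_of_nonneg_left (hsplit y) (V0 s t y)
        _ = _ := by
            simp only [mul_add, Finset.sum_add_distrib, Finset.mul_sum]
            rw [Finset.sum_comm (s := Finset.univ) (t := Finset.univ.erase j),
              Finset.sum_comm (s := Finset.univ) (t := Finset.univ.erase i)]
  rw [superpositionError_eq]
  simp only [avgError_eq]
  have hcard : (0 : ℝ) < Fintype.card (Fin M₁ × Fin M₂) := by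
    simp only [Fintype.card_prod, Fintype.card_fin]
    exact_mod_cast Nat.mul_pos hM₁ hM₂
  calc _ = (1 / (Fintype.card (Fin M₁ × Fin M₂) : ℝ)) * ∑ m : Fin M₁ × Fin M₂,
      ∑ C : Fin M₁ → (Fin n → X₁) × (Fin M₂ → Fin n → X₂), (∏ k, cloudWeight p p₂ M₂ (C k)) *
        ∑ y, blockChannel W (inducedCode φ (fun i => (C i).1) (fun i => (C i).2) m) y *
          ind (¬ DecodesTo q (inducedCode φ (fun i => (C i).1) fun i => (C i).2) y m) := by
        rw [Finset.sum_comm, Finset.mul_sum]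
        refine Finset.sum_congr rfl fun C _ => ?_
        rw [← Finset.mul_sum]
        ring
    _ ≤ (1 / (Fintype.card (Fin M₁ × Fin M₂) : ℝ)) * ∑ m : Fin M₁ × Fin M₂,
        (η + ((M₂ : ℝ) - 1) * a + ((M₁ : ℝ) - 1) * b) := by
        refine mul_le_mul_of_nonneg_left ?_ (by positivity)
        exact Finset.sum_le_sum fun m _ => key m.1 m.2
    _ = _ := by
        rw [Finset.sum_const, nsmul_eq_mul, Finset.card_univ]
        field_simp

/-- The received joint type concentrates around its mean: Chebyshev's inequality, uniformly over
the sent pairs of composition `Q`. -/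
theorem sum_blockChannel_not_mem_le (hn : 1 ≤ n) {W : X → Y → ℝ} (hW : ∀ x, W x ∈ stdSimplex ℝ Y)
    (φ : X₁ × X₂ → X) {Q : X₁ × X₂ → ℝ} {U : Set (X₁ × X₂ × Y → ℝ)} {δ : ℝ} (hδ : 0 < δ)
    (hU : Metric.ball (inducedLaw W φ Q) δ ⊆ U) {s : Fin n → X₁} {t : Fin n → X₂}
    (hst : empirical (fun k => (s k, t k)) = Q) :
    ∑ y, blockChannel W (fun k => φ (s k, t k)) y *
      ind (empirical (fun k => (s k, t k, y k)) ∉ U) ≤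
        Fintype.card (X₁ × X₂ × Y) / δ ^ 2 * (1 / (n : ℝ)) := by
  have hvar : ∀ w : X₁ × X₂ × Y, ∑ y : Fin n → Y, blockChannel W (fun k => φ (s k, t k)) y *
      (empirical (fun k => (s k, t k, y k)) w - inducedLaw W φ Q w) ^ 2 ≤ 1 / (n : ℝ) := by
    rintro ⟨a, b, y₀⟩
    have h := sum_prod_mul_sq_average_le hn (w := fun k => W (φ (s k, t k))) (fun k => hW _)
      (g := fun k y => ind ((s k, t k) = (a, b)) * ind (y = y₀)) (fun k y => by
        rw [abs_of_nonneg (mul_nonneg (ind_nonneg _) (ind_nonneg _))]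
        exact mul_le_one₀ (ind_le_one _) (ind_nonneg _) (ind_le_one _))
    have e1 : ∀ y : Fin n → Y, (1 / (n : ℝ)) * ∑ k, ind ((s k, t k) = (a, b)) * ind (y k = y₀) =
        empirical (fun k => (s k, t k, y k)) (a, b, y₀) := by
      intro y
      rw [empirical_eq_law, law, Finset.mul_sum]
      refine Finset.sum_congr rfl fun k _ => ?_
      simp only [ind, Prod.mk.injEq]
      by_cases h1 : s k = a <;> by_cases h2 : t k = b <;> by_cases h3 : y k = y₀ <;>
        simp [h1, h2, h3]
    have e2 : (1 / (n : ℝ)) * ∑ k, ∑ y, W (φ (s k, t k)) y *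
        (ind ((s k, t k) = (a, b)) * ind (y = y₀)) = inducedLaw W φ Q (a, b, y₀) := by
      rw [inducedLaw, ← hst, empirical_eq_law, law, Finset.mul_sum, Finset.sum_mul]
      refine Finset.sum_congr rfl fun k _ => ?_
      rw [Finset.sum_eq_single y₀ (fun y _ hy => by rw [ind_of_false hy]; ring) (by simp),
        ind_of_true rfl]
      by_cases h1 : (s k, t k) = (a, b)
      · rw [ind_of_true h1, if_pos h1, h1]
        ring
      · rw [ind_of_false h1, if_neg h1]
        ring
    simp only [e1, e2] at h
    exact h
  have hind : ∀ y : Fin n → Y, ind (empirical (fun k => (s k, t k, y k)) ∉ U) ≤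
      ∑ w, (empirical (fun k => (s k, t k, y k)) w - inducedLaw W φ Q w) ^ 2 / δ ^ 2 := by
    intro y
    by_cases h : empirical (fun k => (s k, t k, y k)) ∈ U
    · rw [ind_of_false (not_not.2 h)]
      exact Finset.sum_nonneg fun w _ => by positivity
    · rw [ind_of_true h]
      have hd : ¬ dist (empirical fun k => (s k, t k, y k)) (inducedLaw W φ Q) < δ :=
        fun hlt => h (hU hlt)
      rw [dist_pi_lt_iff hδ] at hd
      push Not at hd
      obtain ⟨w, hw⟩ := hd
      refine le_trans ?_ (Finset.single_le_sum
        (f := fun w => (empirical (fun k => (s k, t k, y k)) w - inducedLaw W φ Q w) ^ 2 / δ ^ 2)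
        (fun w _ => by positivity) (Finset.mem_univ w))
      rw [le_div_iff₀ (by positivity), one_mul, ← sq_abs (_ - _)]
      rw [Real.dist_eq] at hw
      gcongr
  calc _ ≤ ∑ y, blockChannel W (fun k => φ (s k, t k)) y *
        ∑ w, (empirical (fun k => (s k, t k, y k)) w - inducedLaw W φ Q w) ^ 2 / δ ^ 2 :=
        Finset.sum_le_sum fun y _ => mul_le_mul_of_nonneg_left (hind y) (blockChannel_nonneg hW _ _)
    _ = ∑ w, (∑ y : Fin n → Y, blockChannel W (fun k => φ (s k, t k)) y *
        (empirical (fun k => (s k, t k, y k)) w - inducedLaw W φ Q w) ^ 2) / δ ^ 2 := by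
        simp only [Finset.mul_sum, Finset.sum_div]
        rw [Finset.sum_comm]
        exact Finset.sum_congr rfl fun w _ => Finset.sum_congr rfl fun y _ => by ring
    _ ≤ ∑ w : X₁ × X₂ × Y, (1 / (n : ℝ)) / δ ^ 2 :=
        Finset.sum_le_sum fun w _ => by
          gcongr
          exact hvar w
    _ = _ := by
        rw [Finset.sum_const, nsmul_eq_mul, Finset.card_univ]
        ring

/-- Every p.m.f. is a limit of types. -/
theorem exists_types_tendsto {A : Type*} [Fintype A] {P : A → ℝ} (hP : P ∈ stdSimplex ℝ A) :
    ∃ Q : ℕ → A → ℝ, (∀ n, 1 ≤ n → Q n ∈ types A n) ∧ Tendsto Q atTop (𝓝 P) := by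
  -- a memoryless sequence has a type close to `P` with positive probability
  have hex : ∀ n, 1 ≤ n → ∃ x : Fin n → A,
      ∑ a, (empirical x a - P a) ^ 2 ≤ Fintype.card A * (1 / (n : ℝ)) := by
    intro n hn
    have hn0 : (n : ℝ) ≠ 0 := by exact_mod_cast (by omega : n ≠ 0)
    have hb : ∑ x : Fin n → A, (∏ k, P (x k)) * ∑ a, (empirical x a - P a) ^ 2 ≤
        Fintype.card A * (1 / (n : ℝ)) := by
      calc _ = ∑ a, ∑ x : Fin n → A, (∏ k, P (x k)) * (empirical x a - P a) ^ 2 := by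
            rw [Finset.sum_comm]
            exact Finset.sum_congr rfl fun x _ => Finset.mul_sum _ _ _
        _ ≤ ∑ a : A, 1 / (n : ℝ) := Finset.sum_le_sum fun a _ => by
            have h := sum_prod_mul_sq_average_le hn (w := fun _ => P) (fun _ => hP)
              (g := fun _ b => ind (b = a)) fun k b => by
                rw [abs_of_nonneg (ind_nonneg _)]
                exact ind_le_one _
            have e1 : ∀ x : Fin n → A, (1 / (n : ℝ)) * ∑ k, ind (x k = a) = empirical x a := by
              intro x
              rw [empirical_eq_law, law, Finset.mul_sum]
              refine Finset.sum_congr rfl fun k _ => ?_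
              by_cases h1 : x k = a <;> simp [ind, h1]
            have e2 : ∑ b, P b * ind (b = a) = P a := by simp [ind]
            simp only [e1, e2] at h
            simp only [Finset.sum_const, Finset.card_univ, Fintype.card_fin,
              nsmul_eq_mul, one_div, inv_mul_cancel_left₀ hn0] at h
            simpa using h
        _ = _ := by
            rw [Finset.sum_const, nsmul_eq_mul, Finset.card_univ]
    obtain ⟨x, -, hx⟩ := exists_le_of_sum_mul_le
      (fun x : Fin n → A => Finset.prod_nonneg fun k _ => hP.1 (x k))
      (sum_prod_eq_one (w := fun _ : Fin n => P) fun _ => hP.2) hb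
    exact ⟨x, hx⟩
  have : Nonempty A := by
    by_contra h
    rw [not_nonempty_iff] at h
    simpa using hP.2
  choose! x hx using hex
  refine ⟨fun n => empirical (x n), fun n _ => ⟨x n, rfl⟩, tendsto_pi_nhds.2 fun a => ?_⟩
  have hlim : Tendsto (fun n : ℕ => (Fintype.card A : ℝ) * (1 / (n : ℝ))) atTop (𝓝 0) := by
    simpa using (tendsto_one_div_atTop_nhds_zero_nat (𝕜 := ℝ)).const_mul (Fintype.card A : ℝ)
  have hsq : Tendsto (fun n => (empirical (x n) a - P a) ^ 2) atTop (𝓝 0) := by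
    refine squeeze_zero' (Eventually.of_forall fun n => sq_nonneg _) ?_ hlim
    filter_upwards [eventually_ge_atTop 1] with n hn
    exact (Finset.single_le_sum (f := fun a => (empirical (x n) a - P a) ^ 2)
      (fun a _ => sq_nonneg _) (Finset.mem_univ a)).trans (hx n hn)
  have habs : Tendsto (fun n => |empirical (x n) a - P a|) atTop (𝓝 0) := by
    have := hsq.sqrt
    simpa [Real.sqrt_sq_eq_abs] using this
  exact tendsto_sub_nhds_zero_iff.1 ((tendsto_zero_iff_abs_tendsto_zero _).2 habs)

end EnsembleBound

/-! ### The rate functions -/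

section RateFunctions

theorem minOver_le {α : Type*} {S : Set α} {F : α → ℝ} {B : ℝ} (hB : ∀ f ∈ S, B ≤ F f) {f : α}
    (hf : f ∈ S) : minOver S F ≤ F f :=
  csInf_le ⟨B, by rintro _ ⟨g, hg, rfl⟩; exact hB g hg⟩ ⟨f, hf, rfl⟩

theorem le_minOver {α : Type*} {S : Set α} (hS : S.Nonempty) {F : α → ℝ} {c : ℝ}
    (h : ∀ f ∈ S, c ≤ F f) : c ≤ minOver S F :=
  le_csInf (hS.image F) (by rintro _ ⟨g, hg, rfl⟩; exact h g hg)

theorem minOver_equiv {α β : Type*} (e : α ≃ β) {S : Set α} {S' : Set β} {F : α → ℝ} {F' : β → ℝ}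
    (hS : ∀ a, e a ∈ S' ↔ a ∈ S) (hF : ∀ a, F' (e a) = F a) : minOver S' F' = minOver S F := by
  unfold minOver
  congr 1
  ext x
  constructor
  · rintro ⟨b, hb, rfl⟩
    obtain ⟨a, rfl⟩ := e.surjective b
    exact ⟨a, (hS a).1 hb, (hF a).symm⟩
  · rintro ⟨a, ha, rfl⟩
    exact ⟨e a, (hS a).2 ha, hF a⟩

theorem minOver_congr {α : Type*} {S : Set α} {F G : α → ℝ} (h : ∀ f ∈ S, F f = G f) :
    minOver S F = minOver S G := by
  unfold minOver
  rw [Set.image_congr h]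

theorem minOver_add_const {α : Type*} {S : Set α} (hS : S.Nonempty) {F : α → ℝ} {B : ℝ}
    (hB : ∀ f ∈ S, B ≤ F f) (c : ℝ) : minOver S (fun f => F f + c) = minOver S F + c := by
  refine le_antisymm ?_ (le_minOver hS fun f hf => add_le_add (minOver_le hB hf) le_rfl)
  rw [← sub_le_iff_le_add]
  refine le_minOver hS fun f hf => ?_
  rw [sub_le_iff_le_add]
  exact minOver_le (F := fun f => F f + c) (B := B + c)
    (fun g hg => add_le_add (hB g hg) le_rfl) hf

theorem plusPart_nonneg (x : ℝ) : 0 ≤ plusPart x := le_max_left _ _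

/-- Raising the rate of the cognitive user by some amount lowers the bound on the other user's rate
by at most that amount. -/
theorem add_minOver_plusPart_mono {α : Type*} {S : Set α} (hS : S.Nonempty) {F G : α → ℝ}
    (hF : ∀ f ∈ S, 0 ≤ F f) :
    Monotone fun x : ℝ => x + minOver S fun f => F f + plusPart (G f - x) := by
  intro x x' hx
  have h : x - x' + (minOver S fun f => F f + plusPart (G f - x)) ≤
      minOver S fun f => F f + plusPart (G f - x') := by
    refine le_minOver hS fun f hf => ?_
    have h1 : (minOver S fun f => F f + plusPart (G f - x)) ≤ F f + plusPart (G f - x) :=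
      minOver_le (B := 0) (fun g hg => add_nonneg (hF g hg) (plusPart_nonneg _)) hf
    have h2 : plusPart (G f - x) ≤ plusPart (G f - x') + (x' - x) := by
      refine max_le ?_ ?_
      · linarith [plusPart_nonneg (G f - x')]
      · have : G f - x' ≤ plusPart (G f - x') := le_max_right _ _
        linarith
    linarith
  change x + _ ≤ x' + _
  linarith

theorem minOver_plusPart_antitone {α : Type*} {S : Set α} (hS : S.Nonempty) {F G : α → ℝ}
    (hF : ∀ f ∈ S, 0 ≤ F f) :
    Antitone fun x : ℝ => minOver S fun f => F f + plusPart (G f - x) := by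
  intro x x' hx
  refine le_minOver hS fun f hf => ?_
  refine (minOver_le (B := 0) (fun g hg => add_nonneg (hF g hg) (plusPart_nonneg _)) hf).trans ?_
  refine add_le_add le_rfl (max_le_max le_rfl ?_)
  linarith

variable {X₁ X₂ Y : Type*} [Fintype X₁] [Fintype X₂] [Fintype Y] {q P : X₁ × X₂ × Y → ℝ}

theorem mem_setL₀ (hP : P ∈ stdSimplex ℝ (X₁ × X₂ × Y)) : P ∈ setL₀ q P :=
  ⟨⟨⟨hP, rfl⟩, le_rfl⟩, rfl⟩

theorem mem_setL₁ (hP : P ∈ stdSimplex ℝ (X₁ × X₂ × Y)) : P ∈ setL₁ q P :=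
  ⟨⟨⟨hP, rfl⟩, le_rfl⟩, rfl⟩

theorem mem_setL₂ (hP : P ∈ stdSimplex ℝ (X₁ × X₂ × Y)) : P ∈ setL₂ q P :=
  ⟨⟨⟨hP, rfl⟩, le_rfl⟩, rfl⟩

theorem R₂'_nonneg (hP : P ∈ stdSimplex ℝ (X₁ × X₂ × Y)) : 0 ≤ R₂' q P :=
  le_minOver ⟨P, mem_setL₂ hP⟩ fun _ hf => condMutualInfo_nonneg hf.1.1.1 _ _ _

theorem r₁_nonneg (hP : P ∈ stdSimplex ℝ (X₁ × X₂ × Y)) : 0 ≤ r₁ q P :=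
  le_minOver ⟨P, mem_setL₁ hP⟩ fun _ hf => condMutualInfo_nonneg hf.1.1.1 _ _ _

theorem R₁''_nonneg (hP : P ∈ stdSimplex ℝ (X₁ × X₂ × Y)) (r : ℝ) : 0 ≤ R₁'' q P r :=
  le_minOver ⟨P, mem_setL₀ hP⟩ fun _ hf =>
    add_nonneg (mutualInfo_nonneg hf.1.1.1 _ _) (plusPart_nonneg _)

theorem r₂_nonneg (hP : P ∈ stdSimplex ℝ (X₁ × X₂ × Y)) (r : ℝ) : 0 ≤ r₂ q P r :=
  le_minOver ⟨P, mem_setL₀ hP⟩ fun _ hf =>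
    add_nonneg (mutualInfo_nonneg hf.1.1.1 _ _) (plusPart_nonneg _)

theorem add_R₁''_mono (hP : P ∈ stdSimplex ℝ (X₁ × X₂ × Y)) : Monotone fun x => x + R₁'' q P x :=
  add_minOver_plusPart_mono ⟨P, mem_setL₀ hP⟩ fun _ hf => mutualInfo_nonneg hf.1.1.1 _ _

theorem add_r₂_mono (hP : P ∈ stdSimplex ℝ (X₁ × X₂ × Y)) : Monotone fun x => x + r₂ q P x :=
  add_minOver_plusPart_mono ⟨P, mem_setL₀ hP⟩ fun _ hf => mutualInfo_nonneg hf.1.1.1 _ _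

theorem R₁''_antitone (hP : P ∈ stdSimplex ℝ (X₁ × X₂ × Y)) : Antitone (R₁'' q P) :=
  minOver_plusPart_antitone ⟨P, mem_setL₀ hP⟩ fun _ hf => mutualInfo_nonneg hf.1.1.1 _ _

theorem sum_le_of_mem_supRegion (hP : P ∈ stdSimplex ℝ (X₁ × X₂ × Y)) {R : ℝ × ℝ}
    (hR : R ∈ supRegion q P) : R.1 + R.2 ≤ R₂' q P + R₁'' q P (R₂' q P) := by
  have h : R.2 + R₁'' q P R.2 ≤ R₂' q P + R₁'' q P (R₂' q P) := add_R₁''_mono hP hR.2.2.1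
  linarith [hR.2.2.2]

theorem sum_le_of_mem_supRegionReversed (hP : P ∈ stdSimplex ℝ (X₁ × X₂ × Y)) {R : ℝ × ℝ}
    (hR : R ∈ supRegionReversed q P) : R.1 + R.2 ≤ r₁ q P + r₂ q P (r₁ q P) := by
  have h : R.1 + r₂ q P R.1 ≤ r₁ q P + r₂ q P (r₁ q P) := add_r₂_mono hP hR.2.2.1
  linarith [hR.2.2.2]

theorem isGreatest_sum_rate (hP : P ∈ stdSimplex ℝ (X₁ × X₂ × Y)) :
    IsGreatest ((fun R : ℝ × ℝ => R.1 + R.2) '' (supRegion q P ∪ supRegionReversed q P))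
      (max (R₂' q P + R₁'' q P (R₂' q P)) (r₁ q P + r₂ q P (r₁ q P))) := by
  constructor
  · rcases max_choice (R₂' q P + R₁'' q P (R₂' q P)) (r₁ q P + r₂ q P (r₁ q P)) with h | h <;> rw [h]
    · exact ⟨(R₁'' q P (R₂' q P), R₂' q P),
        Or.inl ⟨R₁''_nonneg hP _, R₂'_nonneg hP, le_rfl, le_rfl⟩, add_comm _ _⟩
    · exact ⟨(r₁ q P, r₂ q P (r₁ q P)),
        Or.inr ⟨r₁_nonneg hP, r₂_nonneg hP _, le_rfl, le_rfl⟩, rfl⟩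
  · rintro _ ⟨R, hR | hR, rfl⟩
    · exact (sum_le_of_mem_supRegion hP hR).trans (le_max_left _ _)
    · exact (sum_le_of_mem_supRegionReversed hP hR).trans (le_max_right _ _)

theorem mutualInfo_eq_of_mem_setK {f : X₁ × X₂ × Y → ℝ} (hf : f ∈ setK P) :
    mutualInfo f rvX₁ rvX₂ = mutualInfo P rvX₁ rvX₂ :=
  mutualInfo_eq_of_law_pair_eq hf.2

/-- The binning bound on user 1 is the reversed superposition bound shifted by `I(X₁; X₂)`. -/
theorem R₁'_eq (hP : P ∈ stdSimplex ℝ (X₁ × X₂ × Y)) :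
    R₁' q P = r₁ q P + mutualInfo P rvX₁ rvX₂ := by
  rw [r₁, ← minOver_add_const ⟨P, mem_setL₁ hP⟩ (B := 0)
    (fun _ hf => condMutualInfo_nonneg hf.1.1.1 _ _ _)]
  refine minOver_congr fun f hf => ?_
  rw [mutualInfo_pair, mutualInfo_eq_of_mem_setK hf.1.1, add_comm]

/-- The binning bound on user 2 is the reversed superposition bound, with both rates shifted by
`I(X₁; X₂)`. -/
theorem R₂''_eq (hP : P ∈ stdSimplex ℝ (X₁ × X₂ × Y)) (r : ℝ) :
    R₂'' q P r = r₂ q P (r - mutualInfo P rvX₁ rvX₂) - mutualInfo P rvX₁ rvX₂ := by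
  rw [r₂, sub_eq_add_neg (minOver _ _), ← minOver_add_const ⟨P, mem_setL₀ hP⟩ (B := 0)
    (fun _ hf => add_nonneg (mutualInfo_nonneg hf.1.1.1 _ _) (plusPart_nonneg _))]
  refine minOver_congr fun f hf => ?_
  rw [mutualInfo_pair, mutualInfo_comm f rvX₂ rvX₁, mutualInfo_eq_of_mem_setK hf.1.1]
  have : mutualInfo P rvX₁ rvX₂ + condMutualInfo f rvX₁ rvY rvX₂ - r =
    condMutualInfo f rvX₁ rvY rvX₂ - (r - mutualInfo P rvX₁ rvX₂) := by ring
  rw [this]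
  ring

theorem sum_le_of_mem_binRegionEnlarged (hP : P ∈ stdSimplex ℝ (X₁ × X₂ × Y)) {R : ℝ × ℝ}
    (hR : R ∈ binRegionEnlarged q P) :
    R.1 + R.2 ≤ max (R₂' q P + R₁'' q P (R₂' q P)) (r₁ q P + r₂ q P (r₁ q P)) := by
  obtain ⟨-, a, b, ha, -, hab, h0, h0', h1, h2, h3 | h3⟩ := hR
  · have := sum_le_of_mem_supRegion hP (R := (a, b + R.2)) ⟨h0, h0', h2, h3⟩
    refine le_trans ?_ (le_max_left _ _)
    simp only at this
    linarith
  · refine le_trans ?_ (le_max_right _ _)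
    simp only at h1 h3
    rw [R₁'_eq hP] at h1
    rw [R₂''_eq hP] at h3
    have h : a - mutualInfo P rvX₁ rvX₂ + r₂ q P (a - mutualInfo P rvX₁ rvX₂) ≤
      r₁ q P + r₂ q P (r₁ q P) := add_r₂_mono hP (by linarith)
    linarith

/-! ### Semicontinuity of the minima -/

/-- A minimum of a continuous function over compact sets with closed graph is lower
semicontinuous in the parameter. -/
theorem eventually_forall_mem_lt {Ω : Type*} [Fintype Ω] {S : (Ω → ℝ) → Set (Ω → ℝ)}
    (hS : IsClosed {z : (Ω → ℝ) × (Ω → ℝ) | z.2 ∈ S z.1}) (hK : ∀ P, S P ⊆ stdSimplex ℝ Ω)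
    {F : (Ω → ℝ) → ℝ} (hF : Continuous F) {c : ℝ} {P : Ω → ℝ} (h : ∀ f ∈ S P, c < F f) :
    ∀ᶠ P' in 𝓝 P, ∀ f ∈ S P', c < F f := by
  have key := (isCompact_stdSimplex ℝ Ω).eventually_forall_of_forall_eventually
    (x₀ := P) (P := fun P' f => f ∈ S P' → c < F f) fun f _ => by
      by_cases hf : f ∈ S P
      · have : ∀ᶠ z : (Ω → ℝ) × (Ω → ℝ) in 𝓝 (P, f), c < F z.2 :=
          ((hF.comp continuous_snd).continuousAt).eventually (lt_mem_nhds (h f hf))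
        exact this.mono fun z hz _ => hz
      · have : ∀ᶠ z : (Ω → ℝ) × (Ω → ℝ) in 𝓝 (P, f), z ∈ {z : (Ω → ℝ) × (Ω → ℝ) | z.2 ∈ S z.1}ᶜ :=
          hS.isOpen_compl.mem_nhds hf
        exact this.mono fun z hz hz' => absurd hz' hz
  exact key.mono fun P' hP' f hf => hP' f (hK P' hf) hf

theorem isClosed_setG : IsClosed {z : (X₁ × X₂ × Y → ℝ) × (X₁ × X₂ × Y → ℝ) | z.2 ∈ setG q z.1} := by
  have h1 : IsClosed {z : (X₁ × X₂ × Y → ℝ) × (X₁ × X₂ × Y → ℝ) | z.2 ∈ stdSimplex ℝ (X₁ × X₂ × Y)} :=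
    (isClosed_stdSimplex ℝ (X₁ × X₂ × Y)).preimage continuous_snd
  have h2 : IsClosed {z : (X₁ × X₂ × Y → ℝ) × (X₁ × X₂ × Y → ℝ) |
      law z.2 (pair rvX₁ rvX₂) = law z.1 (pair rvX₁ rvX₂)} :=
    isClosed_eq ((continuous_law _).comp continuous_snd) ((continuous_law _).comp continuous_fst)
  have h3 : IsClosed {z : (X₁ × X₂ × Y → ℝ) × (X₁ × X₂ × Y → ℝ) | expect z.1 q ≤ expect z.2 q} :=
    isClosed_le ((continuous_expect q).comp continuous_fst) ((continuous_expect q).comp continuous_snd)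
  exact (h1.inter h2).inter h3

theorem goodSet_mem_nhds {r c₁ c₂ : ℝ} (h₂ : c₂ < R₂' q P) (h₁ : c₁ < R₁'' q P r) :
    goodSet q r c₁ c₂ ∈ 𝓝 P := by
  have hL₂ : IsClosed {z : (X₁ × X₂ × Y → ℝ) × (X₁ × X₂ × Y → ℝ) | z.2 ∈ setL₂ q z.1} :=
    isClosed_setG.inter (isClosed_eq ((continuous_law (pair rvX₁ rvY)).comp continuous_snd)
      ((continuous_law (pair rvX₁ rvY)).comp continuous_fst))
  have hL₀ : IsClosed {z : (X₁ × X₂ × Y → ℝ) × (X₁ × X₂ × Y → ℝ) | z.2 ∈ setL₀ q z.1} :=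
    isClosed_setG.inter (isClosed_eq ((continuous_law rvY).comp continuous_snd)
      ((continuous_law rvY).comp continuous_fst))
  have hF : Continuous fun f : X₁ × X₂ × Y → ℝ =>
      mutualInfo f rvX₁ rvY + plusPart (condMutualInfo f rvX₂ rvY rvX₁ - r) :=
    (continuous_mutualInfo _ _).add
      (continuous_const.max ((continuous_condMutualInfo _ _ _).sub continuous_const))
  refine (eventually_forall_mem_lt hL₂ (fun _ _ hf => hf.1.1.1)
    (continuous_condMutualInfo rvX₂ rvY rvX₁) fun f hf => ?_).and
    (eventually_forall_mem_lt hL₀ (fun _ _ hf => hf.1.1.1) hF fun f hf => ?_)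
  · exact h₂.trans_le (minOver_le (B := 0) (F := fun f => condMutualInfo f rvX₂ rvY rvX₁)
      (fun g hg => condMutualInfo_nonneg hg.1.1.1 _ _ _) hf)
  · exact h₁.trans_le (minOver_le (B := 0)
      (F := fun f => mutualInfo f rvX₁ rvY + plusPart (condMutualInfo f rvX₂ rvY rvX₁ - r))
      (fun g hg => add_nonneg (mutualInfo_nonneg hg.1.1.1 _ _) (plusPart_nonneg _)) hf)

/-! ### Exchanging the users -/

/-- The exchange of the two users on the sample space. -/
def swapUsers : X₁ × X₂ × Y ≃ X₂ × X₁ × Y where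
  toFun w := (w.2.1, w.1, w.2.2)
  invFun w := (w.2.1, w.1, w.2.2)
  left_inv _ := rfl
  right_inv _ := rfl

theorem law_comp_swapUsers {A : Type*} (f : X₁ × X₂ × Y → ℝ) (U : X₂ × X₁ × Y → A) :
    law (f ∘ swapUsers.symm) U = law f (U ∘ swapUsers) :=
  law_equiv f swapUsers (U ∘ swapUsers)

theorem law_pair_swap {Ω A B : Type*} [Fintype Ω] (f : Ω → ℝ) (U : Ω → A) (V : Ω → B) :
    law f (pair V U) = law f (pair U V) ∘ Prod.swap := by
  funext x
  exact (law_comp_injective f (pair U V) Prod.swap_injective x.swap)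

theorem law_pair_swap_eq_iff {Ω A B : Type*} [Fintype Ω] (f g : Ω → ℝ) (U : Ω → A) (V : Ω → B) :
    law f (pair V U) = law g (pair V U) ↔ law f (pair U V) = law g (pair U V) := by
  constructor <;> intro h
  · rw [law_pair_swap f V U, law_pair_swap g V U, h]
  · rw [law_pair_swap f U V, law_pair_swap g U V, h]

theorem setG_swapUsers (f : X₁ × X₂ × Y → ℝ) :
    f ∘ swapUsers.symm ∈ setG (q ∘ swapUsers.symm) (P ∘ swapUsers.symm) ↔ f ∈ setG q P := by
  have hsum : ∀ g : X₁ × X₂ × Y → ℝ, ∑ w, (g ∘ swapUsers.symm) w = ∑ w, g w := fun g =>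
    Equiv.sum_comp (swapUsers (X₁ := X₁) (X₂ := X₂) (Y := Y)).symm g
  have hexp : ∀ g : X₁ × X₂ × Y → ℝ, expect (g ∘ swapUsers.symm) (q ∘ swapUsers.symm) = expect g q :=
    fun g => hsum fun w => g w * q w
  have hsimp : f ∘ swapUsers.symm ∈ stdSimplex ℝ (X₂ × X₁ × Y) ↔ f ∈ stdSimplex ℝ (X₁ × X₂ × Y) :=
    and_congr ⟨fun h w => h (swapUsers w), fun h w => h _⟩ (by rw [hsum])
  refine and_congr (and_congr hsimp ?_) (by rw [hexp, hexp])
  rw [law_comp_swapUsers, law_comp_swapUsers]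
  exact law_pair_swap_eq_iff f P rvX₁ rvX₂

theorem R₂'_swapUsers : R₂' (q ∘ swapUsers.symm) (P ∘ swapUsers.symm) = r₁ q P := by
  refine minOver_equiv (swapUsers.arrowCongr (Equiv.refl ℝ)) (fun f => ?_) fun f => ?_
  · refine and_congr (setG_swapUsers f) ?_
    change law (f ∘ swapUsers.symm) _ = _ ↔ _
    rw [law_comp_swapUsers, law_comp_swapUsers]
    rfl
  · change condMutualInfo (f ∘ swapUsers.symm) _ _ _ = _
    simp only [condMutualInfo, law_comp_swapUsers]
    rfl

theorem R₁''_swapUsers (r : ℝ) : R₁'' (q ∘ swapUsers.symm) (P ∘ swapUsers.symm) r = r₂ q P r := by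
  refine minOver_equiv (swapUsers.arrowCongr (Equiv.refl ℝ)) (fun f => ?_) fun f => ?_
  · refine and_congr (setG_swapUsers f) ?_
    change law (f ∘ swapUsers.symm) _ = _ ↔ _
    rw [law_comp_swapUsers, law_comp_swapUsers]
    rfl
  · change mutualInfo (f ∘ swapUsers.symm) _ _ + plusPart (condMutualInfo (f ∘ swapUsers.symm) _ _ _
      - r) = _
    simp only [mutualInfo, condMutualInfo, law_comp_swapUsers]
    rfl

end RateFunctions

/-! ### Achievability -/

section Achievability

theorem one_le_numMessages (n : ℕ) (R : ℝ) : 1 ≤ numMessages n R :=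
  Nat.one_le_iff_ne_zero.2 (Nat.ceil_pos.2 (by positivity)).ne'

theorem numMessages_zero_rate (n : ℕ) : numMessages n 0 = 1 := by simp [numMessages]

theorem numMessages_sub_one_le (n : ℕ) (R : ℝ) :
    (numMessages n R : ℝ) - 1 ≤ 2 ^ ((n : ℝ) * R) := by
  have := (Nat.ceil_lt_add_one (show (0 : ℝ) ≤ 2 ^ ((n : ℝ) * R) by positivity)).le
  rw [numMessages]
  linarith

theorem numMessages_le (n : ℕ) {R : ℝ} (hR : 0 ≤ R) :
    (numMessages n R : ℝ) ≤ 2 * 2 ^ ((n : ℝ) * R) := by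
  have h1 : (1 : ℝ) ≤ 2 ^ ((n : ℝ) * R) := Real.one_le_rpow one_le_two (by positivity)
  linarith [numMessages_sub_one_le n R]

theorem le_numMessages (n : ℕ) (R : ℝ) : (2 : ℝ) ^ ((n : ℝ) * R) ≤ numMessages n R :=
  Nat.le_ceil _

/-- Exponential decay beats the polynomial factors. At rate `0` there are no competitors, so that no
condition on the exponent is needed. -/
theorem tendsto_numMessages_mul {R c : ℝ} (h : R = 0 ∨ R < c) (K : ℕ) :
    Tendsto (fun n : ℕ => ((numMessages n R : ℝ) - 1) *
      (((n : ℝ) + 1) ^ K * (2 : ℝ) ^ (-((n : ℝ) * c)))) atTop (𝓝 0) := by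
  rcases h with rfl | h
  · simp [numMessages_zero_rate]
  · set ρ : ℝ := 2 ^ (R - c) with hρ
    have hρ1 : ρ < 1 := Real.rpow_lt_one_of_one_lt_of_neg one_lt_two (by linarith)
    have hρ0 : 0 ≤ ρ := by positivity
    have hlim := (tendsto_pow_const_mul_const_pow_of_lt_one K hρ0 hρ1).const_mul ((2 : ℝ) ^ K)
    rw [mul_zero] at hlim
    refine squeeze_zero' (Eventually.of_forall fun n => ?_) ?_ hlim
    · have : (1 : ℝ) ≤ numMessages n R := by exact_mod_cast one_le_numMessages n R
      exact mul_nonneg (by linarith) (by positivity)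
    · filter_upwards [eventually_ge_atTop 1] with n hn
      have hn1 : (1 : ℝ) ≤ n := by exact_mod_cast hn
      have e : (2 : ℝ) ^ ((n : ℝ) * R) * 2 ^ (-((n : ℝ) * c)) = ρ ^ n := by
        rw [hρ, ← Real.rpow_natCast, ← Real.rpow_mul two_pos.le, ← Real.rpow_add two_pos]
        congr 1
        ring
      calc _ ≤ (2 : ℝ) ^ ((n : ℝ) * R) * ((2 * (n : ℝ)) ^ K * (2 : ℝ) ^ (-((n : ℝ) * c))) := by
            have h2 := numMessages_sub_one_le n R
            gcongr
            linarith
        _ = (2 : ℝ) ^ K * ((n : ℝ) ^ K *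
              ((2 : ℝ) ^ ((n : ℝ) * R) * 2 ^ (-((n : ℝ) * c)))) := by
            rw [mul_pow]
            ring
        _ = _ := by rw [e]

theorem continuous_inducedLaw {X X₁ X₂ Y : Type*} (W : X → Y → ℝ) (φ : X₁ × X₂ → X) :
    Continuous fun Q : X₁ × X₂ → ℝ => inducedLaw W φ Q :=
  continuous_pi fun _ => (continuous_apply _).mul continuous_const

variable {X X₁ X₂ Y : Type*} [Fintype X₁] [Fintype X₂] [Fintype Y] {W : X → Y → ℝ}

theorem inducedLaw_mem_stdSimplex (hW : ∀ x, W x ∈ stdSimplex ℝ Y) (φ : X₁ × X₂ → X)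
    {P₁₂ : X₁ × X₂ → ℝ} (hP₁₂ : P₁₂ ∈ stdSimplex ℝ (X₁ × X₂)) :
    inducedLaw W φ P₁₂ ∈ stdSimplex ℝ (X₁ × X₂ × Y) := by
  refine ⟨fun w => mul_nonneg (hP₁₂.1 _) ((hW _).1 _), ?_⟩
  rw [← hP₁₂.2]
  simp only [Fintype.sum_prod_type, inducedLaw, ← Finset.mul_sum, (hW _).2, mul_one]

theorem superpositionError_nonneg (hW : ∀ x, W x ∈ stdSimplex ℝ Y) (q : X → Y → ℝ)
    (φ : X₁ × X₂ → X) (n M₁ M₂ : ℕ) (Q : X₁ × X₂ → ℝ) :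
    0 ≤ superpositionError W q φ n M₁ M₂ Q := by
  classical
  rw [superpositionError_eq]
  exact Finset.sum_nonneg fun C _ => mul_nonneg (Finset.prod_nonneg fun _ _ =>
    cloudWeight_nonneg (unif_nonneg _) (fun _ => unif_nonneg _) _) (avgError_nonneg hW _ _)

/-- The ensemble-average error probability vanishes at rates inside the superposition region. -/
theorem tendsto_superpositionError (hW : ∀ x, W x ∈ stdSimplex ℝ Y) (q : X → Y → ℝ)
    (φ : X₁ × X₂ → X) {P₁₂ : X₁ × X₂ → ℝ} {Q : ℕ → X₁ × X₂ → ℝ}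
    (hQ : ∀ n, 1 ≤ n → Q n ∈ types (X₁ × X₂) n) (hQlim : Tendsto Q atTop (𝓝 P₁₂)) {R₁ R₂ c₁ c₂ : ℝ}
    (hR₂ : 0 ≤ R₂) (h₁ : R₁ = 0 ∨ R₁ < c₁) (h₂ : R₂ = 0 ∨ R₂ < c₂)
    (hU : goodSet (inducedMetric q φ) R₂ c₁ c₂ ∈ 𝓝 (inducedLaw W φ P₁₂)) :
    Tendsto (fun n => superpositionError W q φ n (numMessages n R₁) (numMessages n R₂) (Q n))
      atTop (𝓝 0) := by
  obtain ⟨δ, hδ, hball⟩ := Metric.mem_nhds_iff.1 hU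
  have hlaw : Tendsto (fun n => inducedLaw W φ (Q n)) atTop (𝓝 (inducedLaw W φ P₁₂)) :=
    ((continuous_inducedLaw W φ).tendsto _).comp hQlim
  have hlim₀ : Tendsto (fun n : ℕ => (Fintype.card (X₁ × X₂ × Y) : ℝ) / (δ / 2) ^ 2 * (1 / (n : ℝ)))
      atTop (𝓝 0) := by
    simpa only [mul_zero] using (tendsto_one_div_atTop_nhds_zero_nat (𝕜 := ℝ)).const_mul
      ((Fintype.card (X₁ × X₂ × Y) : ℝ) / (δ / 2) ^ 2)
  have hlim₂ := tendsto_numMessages_mul h₂ (Fintype.card (X₁ × X₂ × Y) +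
    (Fintype.card X₁ * Fintype.card X₂ + Fintype.card X₁ * Fintype.card Y))
  have hlim₁ := (tendsto_numMessages_mul h₁ (Fintype.card (X₁ × X₂ × Y) +
    (Fintype.card X₁ * Fintype.card X₂ + Fintype.card X₁ * Fintype.card Y) +
    (Fintype.card X₁ + Fintype.card Y))).const_mul 2
  have hlim := (hlim₀.add hlim₂).add hlim₁
  rw [mul_zero, add_zero, add_zero] at hlim
  refine squeeze_zero' (Eventually.of_forall fun n => superpositionError_nonneg hW q φ n _ _ _) ?_
    hlim
  filter_upwards [eventually_ge_atTop 1, hlaw (Metric.ball_mem_nhds _ (half_pos hδ))] with n hn hd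
  have hsub : Metric.ball (inducedLaw W φ (Q n)) (δ / 2) ⊆ goodSet (inducedMetric q φ) R₂ c₁ c₂ :=
    (Metric.ball_subset_ball' (by
      have : dist (inducedLaw W φ (Q n)) (inducedLaw W φ P₁₂) < δ / 2 := hd
      linarith)).trans hball
  refine (superpositionError_le hn hW q φ (hQ n hn) (one_le_numMessages n R₁)
    (one_le_numMessages n R₂) (numMessages_le n hR₂) fun s t hst =>
      sum_blockChannel_not_mem_le hn hW φ (half_pos hδ) hsub hst).trans (le_of_eq ?_)
  rw [pow_add _ (Fintype.card (X₁ × X₂ × Y)) (Fintype.card X₁ * Fintype.card X₂ + _)]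
  ring

theorem superpositionAchievable_of_lt (hW : ∀ x, W x ∈ stdSimplex ℝ Y) (q : X → Y → ℝ)
    (φ : X₁ × X₂ → X) {P₁₂ : X₁ × X₂ → ℝ} (hP₁₂ : P₁₂ ∈ stdSimplex ℝ (X₁ × X₂)) {R : ℝ}
    (hR0 : 0 ≤ R) (hR : R < R₂' (inducedMetric q φ) (inducedLaw W φ P₁₂) +
      R₁'' (inducedMetric q φ) (inducedLaw W φ P₁₂)
        (R₂' (inducedMetric q φ) (inducedLaw W φ P₁₂))) :
    SuperpositionAchievable W q φ P₁₂ R := by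
  have hP := inducedLaw_mem_stdSimplex hW φ hP₁₂
  set P := inducedLaw W φ P₁₂ with hPdef
  set qφ := inducedMetric q φ with hqφ
  have hB0 : 0 ≤ R₂' qφ P := R₂'_nonneg hP
  -- the rate is split so that each part is either zero or strictly inside its bound
  obtain ⟨R₁, R₂, h₁0, h₂0, hsum, h₁, h₂⟩ : ∃ R₁ R₂ : ℝ, 0 ≤ R₁ ∧ 0 ≤ R₂ ∧ R = R₁ + R₂ ∧
      (R₁ = 0 ∨ R₁ < R₁'' qφ P R₂) ∧ (R₂ = 0 ∨ R₂ < R₂' qφ P) := by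
    rcases lt_or_ge R (R₂' qφ P) with h | h
    · exact ⟨0, R, le_rfl, hR0, (zero_add R).symm, Or.inl rfl, Or.inr h⟩
    · set ε := min (R₂' qφ P) ((R₂' qφ P + R₁'' qφ P (R₂' qφ P) - R) / 2) with hε
      have hε0 : 0 ≤ ε := le_min hB0 (by linarith)
      have hε1 : ε ≤ R₂' qφ P := min_le_left _ _
      have hε2 : ε ≤ (R₂' qφ P + R₁'' qφ P (R₂' qφ P) - R) / 2 := min_le_right _ _
      refine ⟨R - R₂' qφ P + ε, R₂' qφ P - ε, by linarith, by linarith, by ring, Or.inr ?_, ?_⟩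
      · have : R₁'' qφ P (R₂' qφ P) ≤ R₁'' qφ P (R₂' qφ P - ε) :=
          R₁''_antitone hP (by linarith)
        linarith
      · rcases hB0.eq_or_lt with h0 | h0
        · left
          linarith
        · right
          have : 0 < ε := lt_min h0 (by linarith)
          linarith
  -- a zero rate needs no room: its threshold may be negative
  have hthr : ∀ {r B : ℝ}, 0 ≤ B → (r = 0 ∨ r < B) → ∃ c, c < B ∧ (r = 0 ∨ r < c) := by
    rintro r B hB (h | h)
    · exact ⟨B - 1, by linarith, Or.inl h⟩
    · obtain ⟨c, hc, hc'⟩ := exists_between h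
      exact ⟨c, hc', Or.inr hc⟩
  obtain ⟨c₁, hc₁, h₁'⟩ := hthr (R₁''_nonneg hP R₂) h₁
  obtain ⟨c₂, hc₂, h₂'⟩ := hthr hB0 h₂
  obtain ⟨Q, hQ, hQlim⟩ := exists_types_tendsto hP₁₂
  exact ⟨R₁, R₂, h₁0, h₂0, hsum, Q, hQ, hQlim,
    tendsto_superpositionError hW q φ hQ hQlim h₂0 h₁' h₂' (goodSet_mem_nhds hc₂ hc₁)⟩

/-- Some codebook is at least as good as the ensemble average. -/
theorem exists_avgError_le_superpositionError (q : X → Y → ℝ) (φ : X₁ × X₂ → X) {n : ℕ}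
    {Q : X₁ × X₂ → ℝ} (hQ : Q ∈ types (X₁ × X₂) n) (M₁ M₂ : ℕ) :
    ∃ c : Fin M₁ × Fin M₂ → Fin n → X,
      avgError W q c ≤ superpositionError W q φ n M₁ M₂ Q := by
  classical
  rw [superpositionError_eq]
  set p := unif (typeClass n (law Q Prod.fst))
  set p₂ : (Fin n → X₁) → (Fin n → X₂) → ℝ := fun s => unif (condTypeClass Q s)
  have w1 : ∑ x, cloudWeight p p₂ M₂ x = 1 :=
    sum_cloudWeight (sum_unif (typeClass_fst_nonempty hQ)) fun s hs =>
      sum_unif (condTypeClass_nonempty hQ (mem_of_unif_ne_zero (S := typeClass n _) hs))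
  obtain ⟨C, -, hC⟩ := exists_le_of_sum_mul_le
    (F := fun C : Fin M₁ → (Fin n → X₁) × (Fin M₂ → Fin n → X₂) =>
      avgError W q (inducedCode φ (fun i => (C i).1) fun i => (C i).2))
    (fun C => Finset.prod_nonneg fun i _ =>
      cloudWeight_nonneg (unif_nonneg _) (fun _ => unif_nonneg _) (C i))
    (sum_prod_eq_one (w := fun _ : Fin M₁ => cloudWeight p p₂ M₂) fun _ => w1) le_rfl
  exact ⟨_, hC⟩

/-- Removing messages from a codebook increases the average error probability at most by the factor
by which the number of messages drops. -/
theorem avgError_comp_le (hW : ∀ x, W x ∈ stdSimplex ℝ Y) (q : X → Y → ℝ) {ι κ : Type*} [Fintype ι]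
    [Fintype κ] [Nonempty ι] [Nonempty κ] {n : ℕ} (c : ι → Fin n → X) (g : κ ↪ ι) {B : ℝ}
    (hB : (Fintype.card ι : ℝ) ≤ B * Fintype.card κ) :
    avgError W q (c ∘ g) ≤ B * avgError W q c := by
  classical
  have hκ : (0 : ℝ) < Fintype.card κ := by exact_mod_cast Fintype.card_pos
  have hι : (0 : ℝ) < Fintype.card ι := by exact_mod_cast Fintype.card_pos
  set e : ι → ℝ := fun m => ∑ y, blockChannel W (c m) y * ind (¬ DecodesTo q c y m) with he
  have e0 : ∀ m, 0 ≤ e m := fun m => Finset.sum_nonneg fun y _ =>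
    mul_nonneg (blockChannel_nonneg hW _ _) (ind_nonneg _)
  have h1 : ∑ m, ∑ y, blockChannel W ((c ∘ g) m) y * ind (¬ DecodesTo q (c ∘ g) y m) ≤ ∑ m, e m := by
    calc _ ≤ ∑ m, e (g m) := Finset.sum_le_sum fun m _ => Finset.sum_le_sum fun y _ => by
          refine mul_le_mul_of_nonneg_left (ind_mono fun hn hd => hn fun m' hm' => ?_)
            (blockChannel_nonneg hW _ _)
          exact hd (g m') fun h => hm' (g.injective h)
      _ = ∑ m ∈ Finset.univ.map g, e m := (Finset.sum_map _ _ _).symm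
      _ ≤ _ := Finset.sum_le_sum_of_subset_of_nonneg (Finset.subset_univ _) fun m _ _ => e0 m
  have h2 : 0 ≤ ∑ m, e m := Finset.sum_nonneg fun m _ => e0 m
  rw [avgError_eq, avgError_eq, ← mul_assoc]
  refine mul_le_mul ?_ h1 (Finset.sum_nonneg fun m _ => Finset.sum_nonneg fun y _ =>
    mul_nonneg (blockChannel_nonneg hW _ _) (ind_nonneg _)) ?_
  · rw [mul_one_div, div_le_div_iff₀ hκ hι]
    linarith
  · have : 0 ≤ B := by
      by_contra hneg
      push Not at hneg
      nlinarith
    positivity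

theorem achievable_of_superpositionAchievable (hW : ∀ x, W x ∈ stdSimplex ℝ Y) {q : X → Y → ℝ}
    {φ : X₁ × X₂ → X} {P₁₂ : X₁ × X₂ → ℝ} [Nonempty X] {R : ℝ}
    (h : SuperpositionAchievable W q φ P₁₂ R) : Achievable W q R := by
  obtain ⟨R₁, R₂, h₁, h₂, rfl, Q, hQ, -, hlim⟩ := h
  have hex : ∀ n, ∃ c : Fin (numMessages n (R₁ + R₂)) → Fin n → X, 1 ≤ n → avgError W q c ≤
      4 * superpositionError W q φ n (numMessages n R₁) (numMessages n R₂) (Q n) := by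
    intro n
    by_cases hn : 1 ≤ n
    · obtain ⟨c, hc⟩ := exists_avgError_le_superpositionError (W := W) q φ (hQ n hn)
        (numMessages n R₁) (numMessages n R₂)
      have hexp : (2 : ℝ) ^ ((n : ℝ) * (R₁ + R₂)) = 2 ^ ((n : ℝ) * R₁) * 2 ^ ((n : ℝ) * R₂) := by
        rw [mul_add, Real.rpow_add two_pos]
      have hle : numMessages n (R₁ + R₂) ≤ numMessages n R₁ * numMessages n R₂ := by
        rw [numMessages, Nat.ceil_le, hexp, Nat.cast_mul]
        exact mul_le_mul (le_numMessages n R₁) (le_numMessages n R₂) (by positivity) (by positivity)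
      obtain ⟨g⟩ : Nonempty (Fin (numMessages n (R₁ + R₂)) ↪
          Fin (numMessages n R₁) × Fin (numMessages n R₂)) :=
        Function.Embedding.nonempty_of_card_le (by simpa using hle)
      have : Nonempty (Fin (numMessages n (R₁ + R₂))) := ⟨⟨0, one_le_numMessages n _⟩⟩
      have : Nonempty (Fin (numMessages n R₁) × Fin (numMessages n R₂)) := ⟨g ⟨0, one_le_numMessages n _⟩⟩
      refine ⟨c ∘ g, fun _ => (avgError_comp_le hW q c g (B := 4) ?_).trans
        (mul_le_mul_of_nonneg_left hc (by norm_num))⟩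
      simp only [Fintype.card_prod, Fintype.card_fin, Nat.cast_mul]
      -- rounding up at most doubles each of the two factors
      calc (numMessages n R₁ : ℝ) * numMessages n R₂
          ≤ (2 * 2 ^ ((n : ℝ) * R₁)) * (2 * 2 ^ ((n : ℝ) * R₂)) :=
            mul_le_mul (numMessages_le n h₁) (numMessages_le n h₂) (by positivity) (by positivity)
        _ = 4 * 2 ^ ((n : ℝ) * (R₁ + R₂)) := by
            rw [hexp]
            ring
        _ ≤ _ := mul_le_mul_of_nonneg_left (le_numMessages n _) (by norm_num)
    · exact ⟨fun _ _ => Classical.arbitrary X, fun h => absurd h hn⟩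
  choose c hc using hex
  refine ⟨add_nonneg h₁ h₂, c, ?_⟩
  have hlim' := hlim.const_mul 4
  rw [mul_zero] at hlim'
  refine squeeze_zero' (Eventually.of_forall fun n => avgError_nonneg hW _ _) ?_ hlim'
  filter_upwards [eventually_ge_atTop 1] with n hn using hc n hn

theorem achievable_zero [Nonempty X] (W q : X → Y → ℝ) : Achievable W q 0 := by
  refine ⟨le_rfl, fun _ _ _ => Classical.arbitrary X, ?_⟩
  -- a single message has no competitor
  have : ∀ n, Subsingleton (Fin (numMessages n 0)) := fun n => by
    rw [numMessages_zero_rate]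
    infer_instance
  have h0 : ∀ n, avgError W q (fun (_ : Fin (numMessages n 0)) (_ : Fin n) =>
      Classical.arbitrary X) = 0 := fun n => by
    rw [avgError_eq, Finset.sum_eq_zero, mul_zero]
    refine fun m _ => Finset.sum_eq_zero fun y _ => ?_
    rw [ind_of_false, mul_zero]
    exact not_not.2 fun m' hm' => absurd (Subsingleton.elim _ _) hm'
  simp only [h0, tendsto_const_nhds]

theorem le_mismatchCapacity [Nonempty X] {W q : X → Y → ℝ} {B : ℝ}
    (h : ∀ R, 0 ≤ R → R < B → Achievable W q R) : (B : EReal) ≤ mismatchCapacity W q := by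
  refine le_of_forall_lt_imp_le_of_dense fun x hx => ?_
  obtain ⟨R, hxR, hRB⟩ := EReal.lt_iff_exists_real_btwn.1 hx
  rw [EReal.coe_lt_coe_iff] at hRB
  rcases le_total 0 R with h0 | h0
  · exact hxR.le.trans (le_sSup ⟨R, h R h0 hRB, rfl⟩)
  · exact (hxR.le.trans (EReal.coe_le_coe_iff.2 h0)).trans (le_sSup ⟨0, achievable_zero W q, rfl⟩)

end Achievability

end Mismatch

theorem corollary3 {X X₁ X₂ Y : Type*} [Fintype X] [Fintype X₁] [Fintype X₂] [Fintype Y]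
    (W : X → Y → ℝ) (hW : ∀ x, W x ∈ stdSimplex ℝ Y) (q : X → Y → ℝ)
    (φ : X₁ × X₂ → X) (P₁₂ : X₁ × X₂ → ℝ) (hP₁₂ : P₁₂ ∈ stdSimplex ℝ (X₁ × X₂))
    (P qφ : X₁ × X₂ × Y → ℝ) (hP : P = inducedLaw W φ P₁₂) (hqφ : qφ = inducedMetric q φ) :
    -- the capacity bound
    ((max (R₂' qφ P + R₁'' qφ P (R₂' qφ P)) (r₁ qφ P + r₂ qφ P (r₁ qφ P)) : ℝ) : EReal)
        ≤ mismatchCapacity W q ∧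
    -- superposition coding with user 2 cognitive achieves the first rate
    (∀ R, 0 ≤ R → R < R₂' qφ P + R₁'' qφ P (R₂' qφ P) →
        SuperpositionAchievable W q φ P₁₂ R) ∧
    -- superposition coding with user 1 cognitive achieves the second rate
    (∀ R, 0 ≤ R → R < r₁ qφ P + r₂ qφ P (r₁ qφ P) →
        SuperpositionAchievable W q (φ ∘ Prod.swap) (P₁₂ ∘ Prod.swap) R) ∧
    -- the maximum is the sum-rate of the union of the two superposition regions
    IsGreatest ((fun R : ℝ × ℝ => R.1 + R.2) '' (supRegion qφ P ∪ supRegionReversed qφ P))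
        (max (R₂' qφ P + R₁'' qφ P (R₂' qφ P)) (r₁ qφ P + r₂ qφ P (r₁ qφ P))) ∧
    -- and it is at least the sum-rate of random binning
    (∀ R ∈ binRegionEnlarged qφ P,
        R.1 + R.2 ≤ max (R₂' qφ P + R₁'' qφ P (R₂' qφ P)) (r₁ qφ P + r₂ qφ P (r₁ qφ P))) := by
  subst hP hqφ
  have hP := inducedLaw_mem_stdSimplex hW φ hP₁₂
  have hX : Nonempty X := by
    by_contra h
    have : IsEmpty (X₁ × X₂) := ⟨fun w => h ⟨φ w⟩⟩
    simpa using hP₁₂.2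
  have h₁ : ∀ R, 0 ≤ R → R < R₂' (inducedMetric q φ) (inducedLaw W φ P₁₂) +
      R₁'' (inducedMetric q φ) (inducedLaw W φ P₁₂)
        (R₂' (inducedMetric q φ) (inducedLaw W φ P₁₂)) →
      SuperpositionAchievable W q φ P₁₂ R :=
    fun R h0 h => superpositionAchievable_of_lt hW q φ hP₁₂ h0 h
  have h₂ : ∀ R, 0 ≤ R → R < r₁ (inducedMetric q φ) (inducedLaw W φ P₁₂) +
      r₂ (inducedMetric q φ) (inducedLaw W φ P₁₂)
        (r₁ (inducedMetric q φ) (inducedLaw W φ P₁₂)) →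
      SuperpositionAchievable W q (φ ∘ Prod.swap) (P₁₂ ∘ Prod.swap) R := by
    intro R h0 h
    have hswap : P₁₂ ∘ Prod.swap ∈ stdSimplex ℝ (X₂ × X₁) :=
      ⟨fun w => hP₁₂.1 _, by rw [← hP₁₂.2]; exact Equiv.sum_comp (Equiv.prodComm X₂ X₁) P₁₂⟩
    refine superpositionAchievable_of_lt hW q (φ ∘ Prod.swap) hswap h0 ?_
    rw [← R₂'_swapUsers, ← R₁''_swapUsers] at h
    exact h
  refine ⟨le_mismatchCapacity fun R h0 h => ?_, h₁, h₂, isGreatest_sum_rate hP,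
    fun R hR => sum_le_of_mem_binRegionEnlarged hP hR⟩
  rcases lt_max_iff.1 h with h | h
  · exact achievable_of_superpositionAchievable hW (h₁ R h0 h)
  · exact achievable_of_superpositionAchievable hW (h₂ R h0 h)
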